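/- Let $\mathcal C[0,1]$ be the space of continuous maps $f:[0,1]\to[0,1]$ with the uniform topology, and give the set of Borel probability measures on $[0,1]$ the weak$^*$ topology, in which all closures are taken. Fix a sequence $\{\Psi_i\}_{i\ge1}$ dense in $\mathcal C[0,1]$ and put $\mathrm{dist}(\mu,\nu)=\sum_{i\ge1}2^{-i}\left|\int\Psi_i\,d\mu-\int\Psi_i\,d\nu\right|$. For $f\in\mathcal C[0,1]$ use the following notions. - For $x\in[0,1]$, $p\omega(x)$ is the set of weak$^*$ limits of convergent subsequences of $\frac1n\sum_{j=0}^{n-1}\delta_{f^j(x)}$, $n\ge1$. A probability measure $\mu$ is pseudo-physical if for every $\varepsilon>0$ the set $\{x\in[0,1]:\mathrm{dist}(p\omega(x),\mu)<\varepsilon\}$ has positive Lebesgue measure; $\mathcal O_f$ is the set of pseudo-physical measures. - $\mathcal M_f$ is the set of $f$-invariant Borel probability measures and $\mathcal E_f\subset\mathcal M_f$ the set of ergodic ones. $\mathrm{Per}_f$ is the set of periodic measures $\frac1r\sum_{j=0}^{r-1}\delta_{f^j(x_0)}$, where $x_0$ is a periodic point of period $r\ge1$. - A nonempty open interval $I\subset[0,1]$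 is periodic shrinking of period $p\ge1$ if the sets $f^j(\overline I)$, $0\le j\le p-1$, are pairwise disjoint, $f^p(\overline I)\subset I$, and $\mathrm{length}(f^j(I))<\mathrm{length}(I)$ for $1\le j\le p-1$. For $q\ge1$ call a measure $\mu$ $q$-shrinked if there is a periodic shrinking interval $I$, of some period $p$, with $\mathrm{length}(I)<1/q$ and $\mu\big(\bigcup_{j=1}^{p}f^j(\overline I)\big)=1$. - $\mathrm{Shr}_f$ is the set of $\mu\in\mathcal M_f$ that are $q$-shrinked for every $q\ge1$. $\mathrm{Shr}_q\mathrm{Per}_f$ is the set of $q$-shrinked measures in $\mathrm{Per}_f$. $\mathrm{AShr}_{\varepsilon,q}\mathrm{Per}_f$ is the set of $\mu\in\mathcal M_f$ such that $\mathrm{dist}(\mu,\nu)<\varepsilon$ for some $\nu\in\mathrm{Shr}_q\mathrm{Per}_f$. **Theorem.** There is a dense $G_\delta$ set $G\subset\mathcal C[0,1]$ such that every $f\in G$ satisfies $$\mathrm{Per}_f\subset\bigcap_{q\ge1}\overline{\mathrm{AShr}_{\varepsilon,q}\mathrm{Per}_f}\qquad\text{for all }\varepsilon>0,$$ and $$\bigcap_{\varepsilon>0}\bigcap_{q\ge1}\overline{\mathrm{AShr}_{\varepsilon,q}\mathrm{Per}_f}=\mathcal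 O_f=\overline{\mathrm{Shr}_f}=\overline{\mathcal E_f}=\overline{\mathrm{Per}_f}.$$ In particular, every ergodic $f$-invariant probability measure is pseudo-physical for $f$. -/

import Mathlib

open Set Filter Topology MeasureTheory unitInterval

noncomputable section

namespace IntervalDynamics

/-- The probability measure `(1/n) ∑_{j<n} δ_{f^j x}`, for `n ≥ 1`. -/
def orbitMeasure (f : C(I, I)) (x : I) (n : ℕ+) : ProbabilityMeasure I :=
  ⟨((n : ℕ) : ENNReal)⁻¹ • ∑ j ∈ Finset.range n, Measure.dirac (f^[j] x), ⟨by
    simp only [Measure.smul_apply, Measure.finsetSum_apply, measure_univ, Finset.sum_const,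
      Finset.card_range, smul_eq_mul, nsmul_eq_mul, mul_one]
    exact ENNReal.inv_mul_cancel (by exact_mod_cast n.ne_zero) (ENNReal.natCast_ne_top _)⟩⟩

/-- The distance `∑_{i ≥ 1} 2^{-i} |∫ Ψ_i dμ - ∫ Ψ_i dν|` between probability measures; the
sequence `Ψ` is enumerated from `0` here. -/
def measureDist (Ψ : ℕ → C(I, I)) (μ ν : ProbabilityMeasure I) : ℝ :=
  ∑' i : ℕ, (1 / 2 ^ (i + 1) : ℝ) *
    |∫ x, (Ψ i x : ℝ) ∂(μ : Measure I) - ∫ x, (Ψ i x : ℝ) ∂(ν : Measure I)|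

/-- `pω(x)`: the weak* limits of the convergent subsequences of the empirical measures of `x`. -/
def pomega (f : C(I, I)) (x : I) : Set (ProbabilityMeasure I) :=
  {μ | ∃ φ : ℕ → ℕ+, StrictMono φ ∧ Tendsto (fun k => orbitMeasure f x (φ k)) atTop (𝓝 μ)}

/-- `A_ε(μ)`: the points `x` with `dist (pω(x), μ) < ε`, the distance from a point to a set being
the infimum of the distances to its elements. -/
def basin (Ψ : ℕ → C(I, I)) (f : C(I, I)) (ε : ℝ) (μ : ProbabilityMeasure I) : Set I :=
  {x | ∃ ν ∈ pomega f x, measureDist Ψ ν μ < ε}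

/-- `O_f`: the pseudo-physical measures of `f`. -/
def pseudoPhysical (Ψ : ℕ → C(I, I)) (f : C(I, I)) : Set (ProbabilityMeasure I) :=
  {μ | ∀ ε : ℝ, 0 < ε → 0 < (volume : Measure I) (basin Ψ f ε μ)}

/-- `M_f`: the `f`-invariant Borel probability measures. -/
def invariantMeasures (f : C(I, I)) : Set (ProbabilityMeasure I) :=
  {μ | MeasurePreserving f (μ : Measure I) (μ : Measure I)}

/-- `E_f`: the ergodic invariant Borel probability measures. -/
def ergodicMeasures (f : C(I, I)) : Set (ProbabilityMeasure I) :=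
  {μ | Ergodic f (μ : Measure I)}

/-- `Per_f`: the invariant measures equidistributed on a periodic orbit. -/
def periodicMeasures (f : C(I, I)) : Set (ProbabilityMeasure I) :=
  {μ | ∃ (x : I) (r : ℕ+), Function.minimalPeriod f x = r ∧ μ = orbitMeasure f x r}

/-- The open interval `(a, b)`, whose closure is `[a, b]`, is periodic shrinking of period `p`.
The length of the interval `f^j((a, b))` is its diameter. -/
structure IsPeriodicShrinking (f : C(I, I)) (a b : I) (p : ℕ) : Prop where
  lt : a < b
  one_le : 1 ≤ p
  disjoint : ∀ i < p, ∀ j < p, i ≠ j → Disjoint (f^[i] '' Icc a b) (f^[j] '' Icc a b)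
  image_subset : f^[p] '' Icc a b ⊆ Ioo a b
  length_lt : ∀ j, 1 ≤ j → j ≤ p - 1 → Metric.diam (f^[j] '' Ioo a b) < (b : ℝ) - a

/-- The compact set `⋃_{j=1}^p f^j([a, b])`. -/
def orbitSet (f : C(I, I)) (a b : I) (p : ℕ) : Set I :=
  ⋃ j ∈ Finset.Icc 1 p, f^[j] '' Icc a b

/-- `μ` is carried by the orbit of a periodic shrinking interval of length less than `1/q`. -/
def IsShrinkedAt (f : C(I, I)) (q : ℕ) (μ : ProbabilityMeasure I) : Prop :=
  ∃ (a b : I) (p : ℕ), IsPeriodicShrinking f a b p ∧ (b : ℝ) - a < 1 / q ∧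
    (μ : Measure I) (orbitSet f a b p) = 1

/-- `Shr_f`: the infinitely shrinked invariant measures. -/
def shrinkedMeasures (f : C(I, I)) : Set (ProbabilityMeasure I) :=
  {μ | μ ∈ invariantMeasures f ∧ ∀ q : ℕ, 1 ≤ q → IsShrinkedAt f q μ}

/-- `Shr_q Per_f`: the `q`-shrinked periodic measures. -/
def shrinkedPeriodic (f : C(I, I)) (q : ℕ) : Set (ProbabilityMeasure I) :=
  {ν | ν ∈ periodicMeasures f ∧ IsShrinkedAt f q ν}

/-- `AShr_{ε,q} Per_f`: the invariant measures `ε`-approached by `q`-shrinked periodic measures. -/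
def approxShrinkedPeriodic (Ψ : ℕ → C(I, I)) (f : C(I, I)) (ε : ℝ) (q : ℕ) :
    Set (ProbabilityMeasure I) :=
  {μ | μ ∈ invariantMeasures f ∧ ∃ ν ∈ shrinkedPeriodic f q, measureDist Ψ μ ν < ε}

end IntervalDynamics

end

open IntervalDynamics

/-!
Every interval map is uniformly close to one that is constant near each of finitely many points and
maps these points to one another, so that each of them ends up in a cycle of periodic shrinking
intervals, which can be taken as short as one likes. Periodic shrinking intervals survive small
perturbations, so Baire's theorem turns this density into two properties of a typical map `f`.

* If orbit segments starting near `c` nearly close up with empirical measures near `μ`, they can be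
  closed by a perturbation; hence for typical `f` they are shadowed by arbitrarily short periodic
  shrinking intervals. The mean ergodic theorem and Poincaré recurrence provide such segments for
  every ergodic `μ` and every `c` in its support.
* If the finitely many points form a fine grid, the cycles capture all but a small proportion of
  `[0, 1]`; hence for typical `f` almost every point falls into arbitrarily short periodic
  shrinking intervals.

All invariant measures carried by the orbit of a short periodic shrinking interval are close to
each other, since the iterates of that interval are short as well. The first property therefore
makes ergodic measures pseudo-physical and limits of shrinked periodic measures, and the second
makes pseudo-physical measures limits of infinitely shrinked ones, which in turn are limits of
periodic measures.
-/

namespace IntervalDynamics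

open Function

/-! ### Empirical measures -/

theorem birkhoffAverage_iterate_of_isPeriodicPt (R : Type*) {α M : Type*} [DivisionSemiring R]
    [AddCommGroup M] [Module R M] {f : α → α} {n : ℕ} {x : α} (hx : IsPeriodicPt f n x)
    (g : α → M) (k : ℕ) : birkhoffAverage R f g n (f^[k] x) = birkhoffAverage R f g n x := by
  induction k with
  | zero => rfl
  | succ k ih =>
    rw [iterate_succ_apply', ← ih, ← sub_eq_zero, birkhoffAverage_apply_sub_birkhoffAverage,
      (hx.apply_iterate k).eq, sub_self, smul_zero]

section EmpiricalMeasure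

variable {X : Type*} [MeasurableSpace X]

/-- The empirical measure `(1/n) ∑_{j<n} δ_{z j}` of the first `n` terms of a sequence. Sequences
that are not orbits are allowed because pseudo-orbits are perturbed point by point. -/
noncomputable def empiricalMeasure (n : ℕ+) (z : ℕ → X) : ProbabilityMeasure X :=
  ⟨((n : ℕ) : ENNReal)⁻¹ • ∑ j ∈ Finset.range n, Measure.dirac (z j), ⟨by
    simp only [Measure.smul_apply, Measure.finsetSum_apply, measure_univ, Finset.sum_const,
      Finset.card_range, smul_eq_mul, nsmul_eq_mul, mul_one]
    exact ENNReal.inv_mul_cancel (by exact_mod_cast n.ne_zero) (ENNReal.natCast_ne_top _)⟩⟩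

theorem orbitMeasure_eq_empiricalMeasure (f : C(I, I)) (x : I) (n : ℕ+) :
    orbitMeasure f x n = empiricalMeasure n fun j ↦ f^[j] x := rfl

theorem coe_empiricalMeasure (n : ℕ+) (z : ℕ → X) :
    (empiricalMeasure n z : Measure X) =
      ((n : ℕ) : ENNReal)⁻¹ • ∑ j ∈ Finset.range n, Measure.dirac (z j) := rfl

theorem empiricalMeasure_congr {n : ℕ+} {z w : ℕ → X} (h : ∀ j < (n : ℕ), z j = w j) :
    empiricalMeasure n z = empiricalMeasure n w :=
  Subtype.ext <| congrArg (((n : ℕ) : ENNReal)⁻¹ • ·) <|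
    Finset.sum_congr rfl fun j hj ↦ by rw [h j (Finset.mem_range.1 hj)]

theorem empiricalMeasure_apply_eq_one {n : ℕ+} {z : ℕ → X} {s : Set X} (hs : MeasurableSet s)
    (h : ∀ j < (n : ℕ), z j ∈ s) : (empiricalMeasure n z : Measure X) s = 1 := by
  have hdirac : ∀ j ∈ Finset.range n, Measure.dirac (z j) s = 1 := fun j hj ↦ by
    rw [Measure.dirac_apply' _ hs, indicator_of_mem (h j (Finset.mem_range.1 hj)), Pi.one_apply]
  rw [coe_empiricalMeasure, Measure.smul_apply, Measure.finsetSum_apply,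
    Finset.sum_congr rfl hdirac]
  simpa using ENNReal.inv_mul_cancel (by exact_mod_cast n.ne_zero) (ENNReal.natCast_ne_top _)

theorem map_empiricalMeasure_iterate {f : X → X} (hf : Measurable f) (n : ℕ+) (x : X) :
    (empiricalMeasure n fun j ↦ f^[j] x).map hf.aemeasurable =
      empiricalMeasure n fun j ↦ f^[j] (f x) := by
  apply Subtype.ext
  rw [ProbabilityMeasure.val_eq_to_measure, ProbabilityMeasure.toMeasure_map, coe_empiricalMeasure,
    Measure.map_smul, Measure.map_finset_sum hf.aemeasurable]
  simp only [Measure.map_dirac' hf, ProbabilityMeasure.val_eq_to_measure, coe_empiricalMeasure,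
    ← iterate_succ_apply', iterate_succ_apply]

section MeasurableSingleton

variable [MeasurableSingletonClass X]

theorem integral_empiricalMeasure (n : ℕ+) (z : ℕ → X) (φ : X → ℝ) :
    ∫ x, φ x ∂(empiricalMeasure n z : Measure X) = (n : ℝ)⁻¹ * ∑ j ∈ Finset.range n, φ (z j) := by
  rw [coe_empiricalMeasure, integral_smul_measure,
    integral_finsetSum_measure fun j _ ↦ integrable_dirac (by simp)]
  simp

theorem integral_empiricalMeasure_iterate (f : X → X) (x : X) (n : ℕ+) (φ : X → ℝ) :
    ∫ y, φ y ∂(empiricalMeasure n fun j ↦ f^[j] x : Measure X) = birkhoffAverage ℝ f φ n x :=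
  integral_empiricalMeasure n _ φ

end MeasurableSingleton

variable [TopologicalSpace X]

theorem continuous_empiricalMeasure [OpensMeasurableSpace X] [T1Space X] (n : ℕ+) :
    Continuous (empiricalMeasure n : (ℕ → X) → ProbabilityMeasure X) := by
  rw [ProbabilityMeasure.continuous_iff_forall_continuous_integral]
  intro φ
  simp only [integral_empiricalMeasure]
  fun_prop

theorem tendsto_empiricalMeasure_iterate_apply [OpensMeasurableSpace X] [T1Space X] {f : X → X}
    {x : X} {α : Type*} {l : Filter α} {n : α → ℕ+}
    (hn : Tendsto (fun a ↦ (n a : ℕ)) l atTop) {μ : ProbabilityMeasure X} :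
    Tendsto (fun a ↦ empiricalMeasure (n a) fun j ↦ f^[j] (f x)) l (𝓝 μ) ↔
      Tendsto (fun a ↦ empiricalMeasure (n a) fun j ↦ f^[j] x) l (𝓝 μ) := by
  simp only [ProbabilityMeasure.tendsto_iff_forall_integral_tendsto,
    integral_empiricalMeasure_iterate]
  refine forall_congr' fun φ ↦ ?_
  have hsub := (tendsto_birkhoffAverage_apply_sub_birkhoffAverage' ℝ
    φ.isBounded_range f x).comp hn
  exact ⟨fun h ↦ by simpa using h.sub hsub, fun h ↦ by simpa using h.add hsub⟩

variable [BorelSpace X] [HasOuterApproxClosed X]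

theorem isClosed_setOf_measure_eq_one {K : Set X} (hK : IsClosed K) :
    IsClosed {μ : ProbabilityMeasure X | (μ : Measure X) K = 1} := by
  refine isClosed_iff_forall_filter.2 fun μ l hl hμl hμ ↦ prob_le_one.antisymm ?_
  have hlim := ProbabilityMeasure.limsup_measure_closed_le_of_tendsto hμ hK
  rw [limsup_congr (v := fun _ ↦ 1) (le_principal_iff.1 hμl), limsup_const] at hlim
  exact hlim

variable [T1Space X] {f : X → X} {x : X}

theorem empiricalMeasure_iterate_apply {n : ℕ+} (hx : IsPeriodicPt f n x) :
    (empiricalMeasure n fun j ↦ f^[j] (f x)) = empiricalMeasure n fun j ↦ f^[j] x := by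
  refine ProbabilityMeasure.toMeasure_injective
    (ext_of_forall_integral_eq_of_IsFiniteMeasure fun φ ↦ ?_)
  simp only [integral_empiricalMeasure_iterate]
  exact birkhoffAverage_iterate_of_isPeriodicPt ℝ hx φ 1

theorem measurePreserving_empiricalMeasure_iterate (hf : Measurable f) {n : ℕ+}
    (hx : IsPeriodicPt f n x) :
    MeasurePreserving f (empiricalMeasure n fun j ↦ f^[j] x : Measure X)
      (empiricalMeasure n fun j ↦ f^[j] x) := by
  refine ⟨hf, congrArg Subtype.val (?_ : ProbabilityMeasure.map _ hf.aemeasurable = _)⟩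
  rw [map_empiricalMeasure_iterate hf, empiricalMeasure_iterate_apply hx]

theorem measurePreserving_of_tendsto_empiricalMeasure (hf : Continuous f) {α : Type*}
    {l : Filter α} [l.NeBot] {n : α → ℕ+} (hn : Tendsto (fun a ↦ (n a : ℕ)) l atTop)
    {μ : ProbabilityMeasure X}
    (hμ : Tendsto (fun a ↦ empiricalMeasure (n a) fun j ↦ f^[j] x) l (𝓝 μ)) :
    MeasurePreserving f (μ : Measure X) μ := by
  refine ⟨hf.measurable, congrArg Subtype.val (?_ : μ.map hf.aemeasurable = _)⟩
  have hmap := ((ProbabilityMeasure.continuous_map hf).tendsto μ).comp hμ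
  refine tendsto_nhds_unique hmap (((tendsto_empiricalMeasure_iterate_apply hn).2 hμ).congr ?_)
  exact fun a ↦ (map_empiricalMeasure_iterate hf.measurable (n a) x).symm

end EmpiricalMeasure

theorem pomega_nonempty (f : C(I, I)) (x : I) : (pomega f x).Nonempty := by
  obtain ⟨μ, φ, hφ, hμ⟩ := CompactSpace.tendsto_subseq fun n : ℕ ↦ orbitMeasure f x n.succPNat
  exact ⟨μ, fun k ↦ (φ k).succPNat, fun i j hij ↦ Nat.succPNat_lt_succPNat.2 (hφ hij), hμ⟩

theorem tendsto_coe_pnat_atTop {φ : ℕ → ℕ+} (hφ : StrictMono φ) :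
    Tendsto (fun k ↦ (φ k : ℕ)) atTop atTop :=
  StrictMono.tendsto_atTop fun _ _ hij ↦ (PNat.coe_lt_coe _ _).2 (hφ hij)

theorem pomega_subset_invariantMeasures (f : C(I, I)) (x : I) :
    pomega f x ⊆ invariantMeasures f := fun _ ⟨_, hφ, hμ⟩ ↦
  measurePreserving_of_tendsto_empiricalMeasure f.continuous (tendsto_coe_pnat_atTop hφ) hμ

theorem pomega_apply (f : C(I, I)) (x : I) : pomega f (f x) = pomega f x :=
  ext fun _ ↦ exists_congr fun _ ↦ and_congr_right fun hφ ↦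
    tendsto_empiricalMeasure_iterate_apply (tendsto_coe_pnat_atTop hφ)

theorem pomega_iterate (f : C(I, I)) (x : I) (m : ℕ) : pomega f (f^[m] x) = pomega f x := by
  induction m with
  | zero => rfl
  | succ m ih => rw [iterate_succ_apply', pomega_apply, ih]

theorem measure_eq_one_of_mem_pomega {f : C(I, I)} {x : I} {K : Set I} (hK : IsClosed K)
    {m : ℕ} (h : ∀ j, f^[j] (f^[m] x) ∈ K) {μ : ProbabilityMeasure I} (hμ : μ ∈ pomega f x) :
    (μ : Measure I) K = 1 := by
  rw [← pomega_iterate f x m] at hμ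
  obtain ⟨φ, -, hμ⟩ := hμ
  exact (isClosed_setOf_measure_eq_one hK).mem_of_tendsto hμ <| .of_forall fun k ↦
    empiricalMeasure_apply_eq_one hK.measurableSet fun j _ ↦ h j

theorem orbitMeasure_mem_invariantMeasures {f : C(I, I)} {x : I} {n : ℕ+}
    (hx : IsPeriodicPt f n x) : orbitMeasure f x n ∈ invariantMeasures f :=
  measurePreserving_empiricalMeasure_iterate f.continuous.measurable hx

/-! ### The distance between measures -/

section MeasureDist

theorem hasSum_one_div_two_pow_succ : HasSum (fun i : ℕ ↦ (1 / 2 ^ (i + 1) : ℝ)) 1 := by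
  convert hasSum_geometric_two' 1 using 2 with i
  rw [pow_succ']
  field_simp

variable {Ψ : ℕ → C(I, I)}

theorem integrable_coe_continuousMap (ψ : C(I, I)) (μ : ProbabilityMeasure I) :
    Integrable (fun x ↦ (ψ x : ℝ)) (μ : Measure I) :=
  (continuous_subtype_val.comp ψ.continuous).integrable_of_hasCompactSupport
    (HasCompactSupport.of_compactSpace _)

theorem abs_integral_sub_integral_le_one (ψ : C(I, I)) (μ ν : ProbabilityMeasure I) :
    |∫ x, (ψ x : ℝ) ∂(μ : Measure I) - ∫ x, (ψ x : ℝ) ∂(ν : Measure I)| ≤ 1 := by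
  have hmem (μ : ProbabilityMeasure I) : ∫ x, (ψ x : ℝ) ∂(μ : Measure I) ∈ Icc (0 : ℝ) 1 :=
    (convex_Icc 0 1).integral_mem isClosed_Icc (.of_forall fun x ↦ (ψ x).2)
      (integrable_coe_continuousMap ψ μ)
  simpa [Real.dist_eq] using Real.dist_le_of_mem_Icc (hmem μ) (hmem ν)

theorem one_div_two_pow_mul_abs_integral_sub_integral_le (Ψ : ℕ → C(I, I))
    (μ ν : ProbabilityMeasure I) (i : ℕ) : (1 / 2 ^ (i + 1) : ℝ) *
      |∫ x, (Ψ i x : ℝ) ∂(μ : Measure I) - ∫ x, (Ψ i x : ℝ) ∂(ν : Measure I)| ≤ 1 / 2 ^ (i + 1) :=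
  mul_le_of_le_one_right (by positivity) (abs_integral_sub_integral_le_one (Ψ i) μ ν)

theorem summable_measureDist (Ψ : ℕ → C(I, I)) (μ ν : ProbabilityMeasure I) :
    Summable fun i : ℕ ↦ (1 / 2 ^ (i + 1) : ℝ) *
      |∫ x, (Ψ i x : ℝ) ∂(μ : Measure I) - ∫ x, (Ψ i x : ℝ) ∂(ν : Measure I)| :=
  .of_nonneg_of_le (fun _ ↦ by positivity)
    (one_div_two_pow_mul_abs_integral_sub_integral_le Ψ μ ν)
    hasSum_one_div_two_pow_succ.summable

theorem measureDist_self (Ψ : ℕ → C(I, I)) (μ : ProbabilityMeasure I) : measureDist Ψ μ μ = 0 := by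
  simp [measureDist]

theorem measureDist_nonneg (Ψ : ℕ → C(I, I)) (μ ν : ProbabilityMeasure I) :
    0 ≤ measureDist Ψ μ ν :=
  tsum_nonneg fun _ ↦ by positivity

theorem measureDist_comm (Ψ : ℕ → C(I, I)) (μ ν : ProbabilityMeasure I) :
    measureDist Ψ μ ν = measureDist Ψ ν μ := by
  simp only [measureDist, abs_sub_comm]

theorem measureDist_triangle (Ψ : ℕ → C(I, I)) (μ ν ρ : ProbabilityMeasure I) :
    measureDist Ψ μ ρ ≤ measureDist Ψ μ ν + measureDist Ψ ν ρ := by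
  have hadd := (summable_measureDist Ψ μ ν).add (summable_measureDist Ψ ν ρ)
  rw [measureDist, measureDist, measureDist,
    ← (summable_measureDist Ψ μ ν).tsum_add (summable_measureDist Ψ ν ρ)]
  refine (summable_measureDist Ψ μ ρ).tsum_le_tsum (fun i ↦ ?_) hadd
  rw [← mul_add]
  gcongr
  exact abs_sub_le _ _ _

theorem continuous_measureDist_left (Ψ : ℕ → C(I, I)) (μ : ProbabilityMeasure I) :
    Continuous fun ν ↦ measureDist Ψ ν μ := by
  refine continuous_tsum (fun i ↦ ?_) hasSum_one_div_two_pow_succ.summable fun i ν ↦ ?_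
  · have hintegral := ProbabilityMeasure.continuous_integral_continuousMap
      (⟨fun x ↦ (Ψ i x : ℝ), continuous_subtype_val.comp (Ψ i).continuous⟩ : C(I, ℝ))
    exact continuous_const.mul (hintegral.sub continuous_const).abs
  · rw [Real.norm_of_nonneg (by positivity)]
    exact one_div_two_pow_mul_abs_integral_sub_integral_le Ψ ν μ i

theorem setOf_measureDist_lt_mem_nhds (Ψ : ℕ → C(I, I)) (μ : ProbabilityMeasure I) {ε : ℝ}
    (hε : 0 < ε) : {ν | measureDist Ψ ν μ < ε} ∈ 𝓝 μ :=
  (continuous_measureDist_left Ψ μ).continuousAt.eventually_lt_const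
    ((measureDist_self Ψ μ).trans_lt hε)

theorem exists_forall_measureDist_lt (Ψ : ℕ → C(I, I)) {ε : ℝ} (hε : 0 < ε) :
    ∃ m : ℕ, ∀ μ ν : ProbabilityMeasure I,
      (∀ i < m, |∫ x, (Ψ i x : ℝ) ∂(μ : Measure I) - ∫ x, (Ψ i x : ℝ) ∂(ν : Measure I)| ≤ ε / 2) →
      measureDist Ψ μ ν < ε := by
  have hw := hasSum_one_div_two_pow_succ
  have hsum := summable_measureDist Ψ
  obtain ⟨m, hm⟩ := ((tendsto_sum_nat_add fun i : ℕ ↦ (1 / 2 ^ (i + 1) : ℝ)).eventually_lt_const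
    (half_pos hε)).exists
  refine ⟨m, fun μ ν h ↦ ?_⟩
  rw [measureDist, ← (hsum μ ν).sum_add_tsum_nat_add m, ← add_halves ε]
  refine add_lt_add_of_le_of_lt ?_ (lt_of_le_of_lt ?_ hm)
  · calc ∑ i ∈ Finset.range m, (1 / 2 ^ (i + 1) : ℝ) *
          |∫ x, (Ψ i x : ℝ) ∂(μ : Measure I) - ∫ x, (Ψ i x : ℝ) ∂(ν : Measure I)|
        ≤ ∑ i ∈ Finset.range m, (1 / 2 ^ (i + 1) : ℝ) * (ε / 2) := by
          gcongr with i hi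
          exact h i (Finset.mem_range.1 hi)
      _ ≤ 1 * (ε / 2) := by
          rw [← Finset.sum_mul]
          gcongr
          exact sum_le_hasSum _ (fun i _ ↦ by positivity) hw
      _ = ε / 2 := one_mul _
  · exact Summable.tsum_le_tsum
      (fun i ↦ one_div_two_pow_mul_abs_integral_sub_integral_le Ψ μ ν (i + m))
      ((hsum μ ν).comp_injective (add_left_injective m))
      (hw.summable.comp_injective (add_left_injective m))

theorem continuous_integral_coe (μ : ProbabilityMeasure I) :
    Continuous fun χ : C(I, I) ↦ ∫ x, (χ x : ℝ) ∂(μ : Measure I) :=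
  continuous_of_dominated (fun χ ↦ (integrable_coe_continuousMap χ μ).aestronglyMeasurable)
    (fun χ ↦ .of_forall fun x ↦ by
      rw [Real.norm_of_nonneg (χ x).2.1]
      exact (χ x).2.2)
    (integrable_const 1)
    (.of_forall fun x ↦ continuous_subtype_val.comp (continuous_eval_const x))

theorem eq_of_forall_integral_coe_eq {μ ν : ProbabilityMeasure I}
    (h : ∀ χ : C(I, I), ∫ x, (χ x : ℝ) ∂(μ : Measure I) = ∫ x, (χ x : ℝ) ∂(ν : Measure I)) :
    μ = ν := by
  refine ProbabilityMeasure.toMeasure_injective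
    (ext_of_forall_integral_eq_of_IsFiniteMeasure fun φ ↦ ?_)
  -- `(φ + M) / (2 M)` takes its values in `[0, 1]` for `M = ‖φ‖ + 1`.
  set M : ℝ := ‖φ‖ + 1
  have : 0 < M := by positivity
  have hmem (x : I) : (φ x + M) / (2 * M) ∈ Icc (0 : ℝ) 1 := by
    have hφ := abs_le.1 (φ.norm_coe_le_norm x)
    rw [mem_Icc, le_div_iff₀ (by positivity), div_le_one (by positivity)]
    constructor <;> linarith
  have hφ (ρ : ProbabilityMeasure I) : ∫ x, (φ x + M) / (2 * M) ∂(ρ : Measure I) =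
      (∫ x, φ x ∂(ρ : Measure I) + M) / (2 * M) := by
    rw [integral_div, integral_add (φ.integrable _) (integrable_const _)]
    simp
  have hintegral := h ⟨fun x ↦ ⟨_, hmem x⟩, by fun_prop⟩
  simp only [ContinuousMap.coe_mk, hφ] at hintegral
  exact add_right_cancel ((div_left_inj' (by positivity)).1 hintegral)

theorem eq_of_measureDist_eq_zero (hΨ : DenseRange Ψ) {μ ν : ProbabilityMeasure I}
    (h : measureDist Ψ μ ν = 0) : μ = ν := by
  have hΨi (i : ℕ) : ∫ x, (Ψ i x : ℝ) ∂(μ : Measure I) = ∫ x, (Ψ i x : ℝ) ∂(ν : Measure I) := by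
    have hterm := congrFun ((hasSum_zero_iff_of_nonneg fun _ ↦ by positivity).1
      ((summable_measureDist Ψ μ ν).hasSum_iff.2 h)) i
    simpa [sub_eq_zero] using hterm
  exact eq_of_forall_integral_coe_eq <| congrFun <|
    hΨ.equalizer (continuous_integral_coe μ) (continuous_integral_coe ν) (funext hΨi)

theorem nhds_basis_measureDist (hΨ : DenseRange Ψ) (μ : ProbabilityMeasure I) :
    (𝓝 μ).HasBasis (fun ε : ℝ ↦ 0 < ε) fun ε ↦ {ν | measureDist Ψ ν μ < ε} := by
  refine ⟨fun U ↦ ⟨fun hU ↦ ?_, fun ⟨ε, hε, hU⟩ ↦ ?_⟩⟩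
  · obtain ⟨ε, hε, hle⟩ := isClosed_compl_iff.2 isOpen_interior |>.isCompact.exists_forall_le'
      (s := (interior U)ᶜ) (continuous_measureDist_left Ψ μ).continuousOn (a := 0) fun ν hν ↦
        (measureDist_nonneg Ψ ν μ).lt_of_ne' fun h0 ↦
          hν (eq_of_measureDist_eq_zero hΨ h0 ▸ mem_interior_iff_mem_nhds.2 hU)
    exact ⟨ε, hε, fun ν hν ↦ interior_subset <| not_not.1 fun h ↦ hν.not_ge (hle ν h)⟩
  · exact mem_of_superset (setOf_measureDist_lt_mem_nhds Ψ μ hε) hU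

theorem mem_closure_iff_measureDist (hΨ : DenseRange Ψ) {S : Set (ProbabilityMeasure I)}
    {μ : ProbabilityMeasure I} :
    μ ∈ closure S ↔ ∀ ε : ℝ, 0 < ε → ∃ ν ∈ S, measureDist Ψ ν μ < ε :=
  mem_closure_iff_nhds_basis (nhds_basis_measureDist hΨ μ)

end MeasureDist

/-! ### Periodic shrinking intervals -/

theorem diam_image_closure {X Y : Type*} [TopologicalSpace X] [PseudoMetricSpace Y] {g : X → Y}
    (hg : Continuous g) (s : Set X) : Metric.diam (g '' closure s) = Metric.diam (g '' s) :=
  congrArg ENNReal.toReal <| le_antisymm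
    ((Metric.ediam_mono (image_closure_subset_closure_image hg)).trans_eq (Metric.ediam_closure _))
    (Metric.ediam_mono (image_mono subset_closure))

theorem isClosed_orbitSet (f : C(I, I)) (a b : I) (p : ℕ) : IsClosed (orbitSet f a b p) :=
  isClosed_biUnion_finset fun j _ ↦ (isCompact_Icc.image (f.continuous.iterate j)).isClosed

namespace IsPeriodicShrinking

variable {f : C(I, I)} {a b : I} {p : ℕ}

theorem diam_image_Icc (h : IsPeriodicShrinking f a b p) (j : ℕ) :
    Metric.diam (f^[j] '' Icc a b) = Metric.diam (f^[j] '' Ioo a b) := by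
  rw [← closure_Ioo h.lt.ne, diam_image_closure (f.continuous.iterate j)]

theorem diam_image_Icc_le (h : IsPeriodicShrinking f a b p) {j : ℕ} (hj : j < p) :
    Metric.diam (f^[j] '' Icc a b) ≤ b - a := by
  rcases Nat.eq_zero_or_pos j with rfl | hj0
  · rw [iterate_zero, image_id]
    refine Metric.diam_le_of_forall_dist_le (sub_nonneg.2 h.lt.le) fun x hx y hy ↦ ?_
    exact Real.dist_le_of_mem_Icc hx hy
  · exact (h.diam_image_Icc j).trans_le (h.length_lt j hj0 (by omega)).le

theorem mapsTo (h : IsPeriodicShrinking f a b p) : MapsTo f^[p] (Icc a b) (Icc a b) :=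
  fun _ hx ↦ Ioo_subset_Icc_self (h.image_subset (mem_image_of_mem _ hx))

theorem iterate_mem_image_mod (h : IsPeriodicShrinking f a b p) {y : I} (hy : y ∈ Icc a b)
    (k : ℕ) : f^[k] y ∈ f^[k % p] '' Icc a b := by
  refine ⟨(f^[p])^[k / p] y, h.mapsTo.iterate _ hy, ?_⟩
  rw [← iterate_mul, ← iterate_add_apply, Nat.mod_add_div]

theorem dist_iterate_le (h : IsPeriodicShrinking f a b p) {y z : I} (hy : y ∈ Icc a b)
    (hz : z ∈ Icc a b) (k : ℕ) : dist (f^[k] y) (f^[k] z) ≤ b - a :=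
  (Metric.dist_le_diam_of_mem Metric.isBounded_of_compactSpace (h.iterate_mem_image_mod hy k)
    (h.iterate_mem_image_mod hz k)).trans (h.diam_image_Icc_le (Nat.mod_lt k h.one_le))

theorem iterate_succ_mem_orbitSet (h : IsPeriodicShrinking f a b p) {y : I} (hy : y ∈ Icc a b)
    (k : ℕ) : f^[k + 1] y ∈ orbitSet f a b p := by
  refine mem_biUnion (Finset.mem_coe.2 <| Finset.mem_Icc.2
    ⟨Nat.le_add_left 1 (k % p), Nat.mod_lt k h.one_le⟩) ?_
  refine ⟨(f^[p])^[k / p] y, h.mapsTo.iterate _ hy, ?_⟩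
  rw [← iterate_mul, ← iterate_add_apply, add_right_comm, Nat.mod_add_div]

theorem exists_minimalPeriod_eq (h : IsPeriodicShrinking f a b p) :
    ∃ z ∈ Ioo a b, minimalPeriod f z = p := by
  obtain ⟨z, hz, hfix⟩ := exists_mem_Icc_isFixedPt_of_mapsTo
    (f.continuous.iterate p).continuousOn h.lt.le h.mapsTo
  have hper : IsPeriodicPt f p z := hfix
  refine ⟨z, hfix ▸ h.image_subset (mem_image_of_mem _ hz), ?_⟩
  refine (hper.minimalPeriod_le h.one_le).antisymm (not_lt.1 fun hlt ↦ ?_)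
  exact disjoint_left.1 (h.disjoint 0 h.one_le _ hlt (hper.minimalPeriod_pos h.one_le).ne)
    ⟨z, hz, rfl⟩ ⟨z, hz, iterate_minimalPeriod⟩

theorem orbitMeasure_orbitSet (h : IsPeriodicShrinking f a b p) {z : I} (hz : z ∈ Icc a b)
    {n : ℕ+} (hn : IsPeriodicPt f n z) : (orbitMeasure f z n : Measure I) (orbitSet f a b p) = 1 :=
  empiricalMeasure_apply_eq_one (isClosed_orbitSet f a b p).measurableSet fun j _ ↦ by
    have hshift : f^[j + (n - 1) + 1] z = f^[j] z := by
      rw [add_assoc, Nat.sub_add_cancel n.pos, iterate_add_apply, hn.eq]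
    exact hshift ▸ h.iterate_succ_mem_orbitSet hz (j + (n - 1))

end IsPeriodicShrinking

/-! ### Orbits of short shrinking intervals determine the measures they carry -/

section MeasurePreserving

variable {α E : Type*} [MeasurableSpace α] [NormedAddCommGroup E] [NormedSpace ℝ E]
  {μ : Measure α} {f : α → α} {φ : α → E}

theorem integral_comp_iterate (hf : MeasurePreserving f μ μ) (hφ : AEStronglyMeasurable φ μ)
    (k : ℕ) : ∫ x, φ (f^[k] x) ∂μ = ∫ x, φ x ∂μ := by
  have hk := hf.iterate k
  conv_rhs => rw [← hk.map_eq]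
  rw [integral_map hk.aemeasurable (hk.map_eq.symm ▸ hφ)]

theorem integrable_birkhoffAverage (hf : MeasurePreserving f μ μ) (hφ : Integrable φ μ) (n : ℕ) :
    Integrable (birkhoffAverage ℝ f φ n) μ :=
  (integrable_finsetSum _ fun k _ ↦ (hf.iterate k).integrable_comp_of_integrable hφ).smul (n : ℝ)⁻¹

theorem integral_birkhoffAverage (hf : MeasurePreserving f μ μ) (hφ : Integrable φ μ) {n : ℕ}
    (hn : n ≠ 0) : ∫ x, birkhoffAverage ℝ f φ n x ∂μ = ∫ x, φ x ∂μ := by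
  have hintegral : ∀ k ∈ Finset.range n, Integrable (fun x ↦ φ (f^[k] x)) μ := fun k _ ↦
    (hf.iterate k).integrable_comp_of_integrable hφ
  simp only [birkhoffAverage, birkhoffSum]
  rw [integral_smul, integral_finsetSum _ hintegral]
  simp [integral_comp_iterate hf hφ.aestronglyMeasurable, ← Nat.cast_smul_eq_nsmul ℝ, hn]

end MeasurePreserving

theorem IsPeriodicShrinking.dist_birkhoffAverage_le {f : C(I, I)} {a b : I} {p : ℕ}
    (h : IsPeriodicShrinking f a b p) {φ : I → ℝ} {ε : ℝ}
    (hφ : ∀ u v : I, dist u v ≤ b - a → dist (φ u) (φ v) ≤ ε) {x z : I}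
    (hx : x ∈ orbitSet f a b p) (hz : z ∈ Icc a b) (hzp : IsPeriodicPt f p z) :
    dist (birkhoffAverage ℝ f φ p x) (birkhoffAverage ℝ f φ p z) ≤ ε := by
  obtain ⟨l, -, y, hy, rfl⟩ := mem_iUnion₂.1 hx
  have hp : (0 : ℝ) < p := by exact_mod_cast h.one_le
  rw [← birkhoffAverage_iterate_of_isPeriodicPt ℝ hzp φ l]
  refine (dist_birkhoffAverage_birkhoffAverage_le ℝ f φ p _ _).trans ((div_le_iff₀' hp).2 ?_)
  refine (Finset.sum_le_card_nsmul _ _ ε fun k _ ↦ hφ _ _ ?_).trans_eq (by simp)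
  simpa only [← iterate_add_apply] using h.dist_iterate_le hy hz (k + l)

theorem IsPeriodicShrinking.dist_integral_le {f : C(I, I)} {a b : I} {p : ℕ+}
    (h : IsPeriodicShrinking f a b p) {φ : I → ℝ} (hφc : Continuous φ) {ε : ℝ}
    (hφ : ∀ u v : I, dist u v ≤ b - a → dist (φ u) (φ v) ≤ ε) {z : I} (hz : z ∈ Icc a b)
    (hzp : IsPeriodicPt f p z) {μ : ProbabilityMeasure I} (hμ : μ ∈ invariantMeasures f)
    (hμ1 : (μ : Measure I) (orbitSet f a b p) = 1) :
    dist (∫ x, φ x ∂(μ : Measure I)) (∫ x, φ x ∂(orbitMeasure f z p : Measure I)) ≤ ε := by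
  have hφi : Integrable φ (μ : Measure I) :=
    hφc.integrable_of_hasCompactSupport (HasCompactSupport.of_compactSpace _)
  have hae : ∀ᵐ x ∂(μ : Measure I), x ∈ orbitSet f a b p :=
    (prob_compl_eq_zero_iff (isClosed_orbitSet f a b p).measurableSet).2 hμ1
  set c := birkhoffAverage ℝ f φ p z
  have hsub : ∫ x, φ x ∂(μ : Measure I) - c =
      ∫ x, (birkhoffAverage ℝ f φ p x - c) ∂(μ : Measure I) := by
    rw [integral_sub (integrable_birkhoffAverage hμ hφi p) (integrable_const c),
      integral_birkhoffAverage hμ hφi p.ne_zero]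
    simp
  rw [orbitMeasure_eq_empiricalMeasure, integral_empiricalMeasure_iterate, dist_eq_norm, hsub]
  refine (norm_integral_le_of_norm_le_const (C := ε) (hae.mono fun x hx ↦ ?_)).trans (by simp)
  exact h.dist_birkhoffAverage_le hφ hx hz hzp

theorem exists_forall_isPeriodicShrinking_measureDist_lt (Ψ : ℕ → C(I, I)) {ε : ℝ} (hε : 0 < ε) :
    ∃ q : ℕ, 1 ≤ q ∧ ∀ (f : C(I, I)) (a b : I) (p : ℕ+), IsPeriodicShrinking f a b p →
      (b : ℝ) - a < 1 / q → ∀ z ∈ Icc a b, IsPeriodicPt f p z → ∀ μ ∈ invariantMeasures f,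
      (μ : Measure I) (orbitSet f a b p) = 1 → measureDist Ψ μ (orbitMeasure f z p) < ε := by
  obtain ⟨m, hm⟩ := exists_forall_measureDist_lt Ψ hε
  have huc (i : ℕ) : ∃ η > 0, ∀ ⦃u v : I⦄, dist u v < η → dist (Ψ i u) (Ψ i v) < ε / 2 :=
    Metric.uniformContinuous_iff.1
      (CompactSpace.uniformContinuous_of_continuous (Ψ i).continuous) _ (half_pos hε)
  choose η hη hηd using huc
  have hq : ∀ᶠ q : ℕ in atTop, ∀ i < m, 1 / (q : ℝ) < η i :=
    (finite_lt_nat m).eventually_all.2 fun i _ ↦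
      tendsto_one_div_atTop_nhds_zero_nat.eventually_lt_const (hη i)
  obtain ⟨q, hq, hq1⟩ := (hq.and (eventually_ge_atTop 1)).exists
  refine ⟨q, hq1, fun f a b p h hab z hz hzp μ hμ hμ1 ↦ hm _ _ fun i hi ↦ ?_⟩
  refine h.dist_integral_le (continuous_subtype_val.comp (Ψ i).continuous) (fun u v huv ↦ ?_)
    hz hzp hμ hμ1
  exact (hηd i (huv.trans_lt (hab.trans (hq i hi)))).le

/-! ### Stability under perturbation -/

section Stability

variable {X : Type*} [TopologicalSpace X] [LocallyCompactSpace X]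

theorem continuous_iterate_apply (n : ℕ) : Continuous fun q : C(X, X) × X ↦ q.1^[n] q.2 := by
  induction n with
  | zero => exact continuous_snd
  | succ n ih =>
    simp only [iterate_succ_apply']
    exact continuous_eval.comp (continuous_fst.prodMk ih)

theorem eventually_mapsTo_iterate {f : C(X, X)} {n : ℕ} {K U : Set X} (hK : IsCompact K)
    (hU : IsOpen U) (h : MapsTo f^[n] K U) : ∀ᶠ g : C(X, X) in 𝓝 f, MapsTo g^[n] K U :=
  hK.eventually_forall_of_forall_eventually fun _ hx ↦
    (hU.preimage (continuous_iterate_apply n)).mem_nhds (h hx)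

theorem eventually_disjoint_image_iterate [T2Space X] {f : C(X, X)} {m n : ℕ} {K L : Set X}
    (hK : IsCompact K) (hL : IsCompact L) (h : Disjoint (f^[m] '' K) (f^[n] '' L)) :
    ∀ᶠ g : C(X, X) in 𝓝 f, Disjoint (g^[m] '' K) (g^[n] '' L) := by
  obtain ⟨U, V, hU, hV, hKU, hLV, hUV⟩ := SeparatedNhds.of_isCompact_isCompact
    (hK.image (f.continuous.iterate m)) (hL.image (f.continuous.iterate n)) h
  filter_upwards [eventually_mapsTo_iterate hK hU (mapsTo_iff_image_subset.2 hKU),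
    eventually_mapsTo_iterate hL hV (mapsTo_iff_image_subset.2 hLV)] with g hgK hgL
  exact hUV.mono hgK.image_subset hgL.image_subset

end Stability

theorem continuous_orbitMeasure (n : ℕ+) :
    Continuous fun q : C(I, I) × I ↦ orbitMeasure q.1 q.2 n :=
  (continuous_empiricalMeasure n).comp (continuous_pi fun j ↦ continuous_iterate_apply j)

theorem eventually_diam_image_iterate_lt {X : Type*} [PseudoMetricSpace X] [LocallyCompactSpace X]
    {f : C(X, X)} {n : ℕ} {K : Set X} (hK : IsCompact K) {r : ℝ}
    (h : Metric.diam (f^[n] '' K) < r) : ∀ᶠ g : C(X, X) in 𝓝 f, Metric.diam (g^[n] '' K) < r := by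
  have hfK : IsCompact (f^[n] '' K) := hK.image (f.continuous.iterate n)
  obtain ⟨δ, hδ, hδr⟩ : ∃ δ > 0, Metric.diam (f^[n] '' K) + 2 * δ < r :=
    ⟨(r - Metric.diam (f^[n] '' K)) / 3, by linarith, by linarith⟩
  filter_upwards [eventually_mapsTo_iterate hK Metric.isOpen_thickening (mapsTo_iff_image_subset.2
    (Metric.self_subset_thickening hδ (f^[n] '' K)))] with g hg
  exact (Metric.diam_mono hg.image_subset hfK.isBounded.thickening).trans_lt
    ((Metric.diam_thickening_le _ hδ.le).trans_lt hδr)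

theorem IsPeriodicShrinking.eventually {f : C(I, I)} {a b : I} {p : ℕ}
    (h : IsPeriodicShrinking f a b p) : ∀ᶠ g in 𝓝 f, IsPeriodicShrinking g a b p := by
  have hdisj : ∀ᶠ g : C(I, I) in 𝓝 f, ∀ i < p, ∀ j < p, i ≠ j →
      Disjoint (g^[i] '' Icc a b) (g^[j] '' Icc a b) :=
    (finite_lt_nat p).eventually_all.2 fun i hi ↦ (finite_lt_nat p).eventually_all.2 fun j hj ↦
      eventually_imp_distrib_left.2 fun hij ↦
        eventually_disjoint_image_iterate isCompact_Icc isCompact_Icc (h.disjoint i hi j hj hij)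
  have hlength : ∀ᶠ g : C(I, I) in 𝓝 f, ∀ j ∈ Icc 1 (p - 1),
      Metric.diam (g^[j] '' Icc a b) < (b : ℝ) - a :=
    (finite_Icc 1 (p - 1)).eventually_all.2 fun j hj ↦ eventually_diam_image_iterate_lt
      isCompact_Icc ((h.diam_image_Icc j).trans_lt (h.length_lt j hj.1 hj.2))
  filter_upwards [hdisj, hlength, eventually_mapsTo_iterate isCompact_Icc isOpen_Ioo
    (mapsTo_iff_image_subset.2 h.image_subset)] with g hgdisj hglength hgsubset
  exact ⟨h.lt, h.one_le, hgdisj, hgsubset.image_subset, fun j hj hj' ↦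
    (Metric.diam_mono (image_mono Ioo_subset_Icc_self)
      Metric.isBounded_of_compactSpace).trans_lt (hglength j ⟨hj, hj'⟩)⟩

/-! ### Finite models -/

theorem exists_continuousMap_forall_dist_lt_forall_eqOn {X ι : Type*} [TopologicalSpace X]
    [NormalSpace X] [ParacompactSpace X] [Finite ι] {K : ι → Set X} (hK : ∀ i, IsClosed (K i))
    (hdisj : Pairwise (Disjoint on K)) (f : C(X, I)) {c : ι → I} {η : ℝ} (hη : 0 < η)
    (hc : ∀ i, ∀ x ∈ K i, dist (c i) (f x) < η) :
    ∃ g : C(X, I), (∀ x, dist (g x) (f x) < η) ∧ ∀ i, EqOn g (fun _ ↦ c i) (K i) := by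
  let t (x : X) : Set ℝ := Icc 0 1 ∩ Metric.ball (f x) η ∩ {v | ∀ i, x ∈ K i → v = c i}
  have ht (x : X) : Convex ℝ (t x) := by
    refine ((convex_Icc 0 1).inter (convex_ball _ _)).inter ?_
    simp only [ofPred_forall]
    exact convex_iInter fun i ↦ convex_iInter fun _ ↦ convex_singleton _
  have hlocal (x : X) : ∃ U ∈ 𝓝 x, ∃ g : X → ℝ, ContinuousOn g U ∧ ∀ z ∈ U, g z ∈ t z := by
    have hcompl (S : Set ι) (hS : ∀ j ∈ S, x ∉ K j) : ∀ᶠ z in 𝓝 x, ∀ j ∈ S, z ∉ K j :=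
      S.toFinite.eventually_all.2 fun j hj ↦ (hK j).isOpen_compl.mem_nhds (hS j hj)
    by_cases hx : ∃ i, x ∈ K i
    · obtain ⟨i, hi⟩ := hx
      have hother : ∀ j ∈ ({i}ᶜ : Set ι), x ∉ K j := fun j hj hxj ↦
        (hdisj hj).notMem_of_mem_left hxj hi
      have hclose : ∀ᶠ z in 𝓝 x, dist (c i) (f z) < η :=
        (continuous_const.dist f.continuous).continuousAt.eventually_lt_const (hc i x hi)
      refine ⟨_, (hcompl _ hother).and hclose, fun _ ↦ c i, continuousOn_const, fun z hz ↦
        ⟨⟨(c i).2, hz.2⟩, fun j hj ↦ ?_⟩⟩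
      exact congrArg (fun k ↦ (c k : ℝ)) (by_contra fun hne ↦ hz.1 j (Ne.symm hne) hj)
    · exact ⟨_, hcompl univ fun j _ hj ↦ hx ⟨j, hj⟩, fun z ↦ f z, by fun_prop, fun z hz ↦
        ⟨⟨(f z).2, Metric.mem_ball_self hη⟩, fun j hj ↦ (hz j (mem_univ j) hj).elim⟩⟩
  obtain ⟨g, hg⟩ := exists_continuous_forall_mem_convex_of_local ht hlocal
  exact ⟨⟨fun x ↦ ⟨g x, (hg x).1.1⟩, by fun_prop⟩, fun x ↦ (hg x).1.2,
    fun i x hx ↦ Subtype.ext ((hg x).2 i hx)⟩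

/-- The map `g` sends a whole neighbourhood `K i` of `y i` to the single point `y (τ i)`, so that
its dynamics on `⋃ i, K i` is that of the map `τ` on the index set. -/
structure IsFiniteModel {X ι : Type*} [TopologicalSpace X] (g : X → X) (K : ι → Set X) (y : ι → X)
    (τ : ι → ι) : Prop where
  pairwise_disjoint : Pairwise (Disjoint on K)
  mem_nhds : ∀ i, K i ∈ 𝓝 (y i)
  eqOn : ∀ i, EqOn g (fun _ ↦ y (τ i)) (K i)

namespace IsFiniteModel

section TopologicalSpace

variable {X ι : Type*} [TopologicalSpace X] {g : X → X} {K : ι → Set X} {y : ι → X} {τ : ι → ι}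

theorem mapsTo_iterate (h : IsFiniteModel g K y τ) (i : ι) (j : ℕ) :
    MapsTo g^[j] (K i) (K (τ^[j] i)) := by
  induction j with
  | zero => exact mapsTo_id _
  | succ j ih =>
    intro x hx
    rw [iterate_succ_apply', iterate_succ_apply', h.eqOn _ (ih hx)]
    exact mem_of_mem_nhds (h.mem_nhds _)

theorem iterate_succ_apply (h : IsFiniteModel g K y τ) {i : ι} {x : X} (hx : x ∈ K i) (j : ℕ) :
    g^[j + 1] x = y (τ^[j + 1] i) := by
  rw [iterate_succ_apply', iterate_succ_apply', h.eqOn _ (h.mapsTo_iterate i j hx)]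

theorem iterate_apply (h : IsFiniteModel g K y τ) (i : ι) (j : ℕ) :
    g^[j] (y i) = y (τ^[j] i) := by
  cases j with
  | zero => rfl
  | succ j => exact h.iterate_succ_apply (mem_of_mem_nhds (h.mem_nhds i)) j

end TopologicalSpace

theorem isPeriodicShrinking {ι : Type*} {g : C(I, I)} {K : ι → Set I} {y : ι → I} {τ : ι → ι}
    (h : IsFiniteModel g K y τ) {i : ι} (hi : i ∈ periodicPts τ) {a b : I} (ha : a < y i)
    (hb : y i < b) (hab : Icc a b ⊆ K i) : IsPeriodicShrinking g a b (minimalPeriod τ i) := by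
  have hpos := minimalPeriod_pos_of_mem_periodicPts hi
  have himage (j : ℕ) : g^[j] '' Icc a b ⊆ K (τ^[j] i) :=
    (image_mono hab).trans (h.mapsTo_iterate i j).image_subset
  have hconst (j : ℕ) (hj : 1 ≤ j) : g^[j] '' Icc a b ⊆ {y (τ^[j] i)} :=
    image_subset_iff.2 fun x hx ↦ Nat.sub_add_cancel hj ▸ h.iterate_succ_apply (hab hx) (j - 1)
  refine ⟨ha.trans hb, hpos, fun j hj k hk hjk ↦ ?_, ?_, fun j hj _ ↦ ?_⟩
  · exact (h.pairwise_disjoint fun heq ↦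
      hjk (iterate_injOn_Iio_minimalPeriod hj hk heq)).mono (himage j) (himage k)
  · refine (hconst _ hpos).trans (singleton_subset_iff.2 ?_)
    rw [iterate_minimalPeriod]
    exact ⟨ha, hb⟩
  · rw [Metric.diam_subsingleton (subsingleton_singleton.anti
      ((image_mono Ioo_subset_Icc_self).trans (hconst j hj)))]
    exact sub_pos.2 (ha.trans hb)

end IsFiniteModel

theorem exists_Icc_subset_of_mem_nhds {y : I} (hy : y ∈ Ioo 0 1) {N : Set I} (hN : N ∈ 𝓝 y) :
    ∃ a b, a < y ∧ y < b ∧ Icc a b ⊆ N := by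
  obtain ⟨a, b, ⟨ha, hb⟩, hab⟩ := (mem_nhds_iff_exists_Ioo_subset' ⟨0, hy.1⟩ ⟨1, hy.2⟩).1 hN
  obtain ⟨a', ha', hay⟩ := exists_between ha
  obtain ⟨b', hyb, hb'⟩ := exists_between hb
  exact ⟨a', b', hay, hyb, (Icc_subset_Ioo ha' hb').trans hab⟩

theorem IsFiniteModel.exists_isPeriodicShrinking {ι : Type*} {g : C(I, I)} {K : ι → Set I}
    {y : ι → I} {τ : ι → ι} (h : IsFiniteModel g K y τ) {i : ι} (hi : i ∈ periodicPts τ)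
    (hy : y i ∈ Ioo 0 1) {N : Set I} (hN : N ∈ 𝓝 (y i)) {δ : ℝ} (hδ : 0 < δ) :
    ∃ a b, a < y i ∧ y i < b ∧ Icc a b ⊆ N ∧ (b : ℝ) - a < δ ∧
      IsPeriodicShrinking g a b (minimalPeriod τ i) := by
  obtain ⟨a, b, ha, hb, hab⟩ := exists_Icc_subset_of_mem_nhds hy
    (inter_mem (inter_mem (h.mem_nhds i) hN) (Metric.ball_mem_nhds _ (half_pos hδ)))
  have hle : a ≤ b := (ha.trans hb).le
  have hdist : dist a b < δ := by
    simpa using (dist_triangle_right a b (y i)).trans_lt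
      (add_lt_add (hab (left_mem_Icc.2 hle)).2 (hab (right_mem_Icc.2 hle)).2)
  refine ⟨a, b, ha, hb, fun x hx ↦ (hab hx).1.2, ?_,
    h.isPeriodicShrinking hi ha hb fun x hx ↦ (hab hx).1.1⟩
  rw [dist_comm, Subtype.dist_eq, Real.dist_eq] at hdist
  exact (le_abs_self _).trans_lt hdist

section Existence

variable {ι : Type*} [Finite ι] {y : ι → I} {τ : ι → ι} (f : C(I, I)) {η : ℝ}

theorem exists_isFiniteModel_of_isClosed {K : ι → Set I} (hK : ∀ i, IsClosed (K i))
    (hdisj : Pairwise (Disjoint on K)) (hmem : ∀ i, K i ∈ 𝓝 (y i)) (hη : 0 < η)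
    (h : ∀ i, ∀ x ∈ K i, dist (y (τ i)) (f x) < η) :
    ∃ g : C(I, I), dist g f < η ∧ IsFiniteModel g K y τ := by
  obtain ⟨g, hgf, hg⟩ := exists_continuousMap_forall_dist_lt_forall_eqOn hK hdisj f hη h
  exact ⟨g, (ContinuousMap.dist_lt_iff hη).2 hgf, hdisj, hmem, hg⟩

theorem exists_isFiniteModel (hy : Injective y) (hη : 0 < η)
    (h : ∀ i, dist (y (τ i)) (f (y i)) < η) :
    ∃ (g : C(I, I)) (K : ι → Set I), dist g f < η ∧ IsFiniteModel g K y τ := by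
  have hopen (i : ι) : {x | dist (y (τ i)) (f x) < η} ∈ 𝓝 (y i) :=
    (isOpen_lt (continuous_const.dist f.continuous) continuous_const).mem_nhds (h i)
  obtain ⟨K, hK, hdisj⟩ := (pairwise_disjoint_nhds.comp_of_injective hy)
    |>.exists_mem_filter_basis_of_disjoint fun i ↦
      (closed_nhds_basis (y i)).restrict_subset (hopen i)
  obtain ⟨g, hgf, hg⟩ := exists_isFiniteModel_of_isClosed f (fun i ↦ (hK i).1.2) hdisj
    (fun i ↦ (hK i).1.1) hη fun i x hx ↦ (hK i).2 hx
  exact ⟨g, K, hgf, hg⟩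

end Existence

/-! ### Closing nearly periodic orbits -/

theorem dense_setOf_injective_forall_notMem {X ι : Type*} [TopologicalSpace X] [T1Space X]
    [∀ x : X, (𝓝[≠] x).NeBot] [Finite ι] {t : Set X} (ht : t.Finite) :
    Dense {y : ι → X | Injective y ∧ ∀ i, y i ∉ t} := by
  classical
  cases nonempty_fintype ι
  refine dense_iff_inter_open.2 fun O hO ⟨y, hy⟩ ↦ ?_
  obtain ⟨u, hu, huO⟩ := isOpen_pi_iff'.1 hO y hy
  have hinf (i : ι) : (u i \ t).Infinite :=
    (infinite_of_mem_nhds (y i) ((hu i).1.mem_nhds (hu i).2)).sdiff ht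
  choose s hs hscard using fun i ↦ (hinf i).exists_subset_card_eq (Fintype.card ι)
  obtain ⟨z, hz, hzs⟩ := (Finset.all_card_le_biUnion_card_iff_exists_injective s).1 fun A ↦ by
    rcases A.eq_empty_or_nonempty with rfl | ⟨i, hi⟩
    · simp
    · exact A.card_le_univ.trans ((hscard i).ge.trans
        (Finset.card_le_card (Finset.subset_biUnion_of_mem s hi)))
  exact ⟨z, huO fun i _ ↦ (hs i (hzs i)).1, hz, fun i ↦ (hs i (hzs i)).2⟩

/-- The maps with a periodic shrinking interval of length less than `1/q` all of whose points,
paired with their empirical measures over one period, lie in `W`. -/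
def shrinkingIn (W : Set (I × ProbabilityMeasure I)) (q : ℕ) : Set C(I, I) :=
  {f | ∃ (a b : I) (p : ℕ+), IsPeriodicShrinking f a b p ∧ (b : ℝ) - a < 1 / q ∧
    ∀ x ∈ Icc a b, (x, orbitMeasure f x p) ∈ W}

section ShrinkingIn

variable {W : Set (I × ProbabilityMeasure I)} {q : ℕ} {f : C(I, I)}

theorem isOpen_shrinkingIn (hW : IsOpen W) : IsOpen (shrinkingIn W q) := by
  refine isOpen_iff_mem_nhds.2 fun f ⟨a, b, p, h, hab, hfW⟩ ↦ ?_
  have hcont : Continuous fun r : C(I, I) × I ↦ (r.2, orbitMeasure r.1 r.2 p) :=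
    continuous_snd.prodMk (continuous_orbitMeasure p)
  have hgW : ∀ᶠ g : C(I, I) in 𝓝 f, ∀ x ∈ Icc a b, (x, orbitMeasure g x p) ∈ W :=
    isCompact_Icc.eventually_forall_of_forall_eventually fun x hx ↦
      (hW.preimage hcont).mem_nhds (hfW x hx)
  filter_upwards [h.eventually, hgW] with g hg hgW
  exact ⟨a, b, p, hg, hab, hgW⟩

theorem exists_mem_shrinkingIn_dist_lt (hW : IsOpen W) (hq : 1 ≤ q) {n : ℕ+} {y : ZMod n → I}
    (hinj : Injective y) (hy : y 0 ∈ Ioo 0 1) {ε : ℝ} (hε : 0 < ε)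
    (hstep : ∀ i, dist (y (1 + i)) (f (y i)) < ε)
    (hyW : (y 0, empiricalMeasure n fun j ↦ y j) ∈ W) : ∃ g ∈ shrinkingIn W q, dist g f < ε := by
  obtain ⟨g, K, hgf, hg⟩ := exists_isFiniteModel f (τ := (1 + ·)) hinj hε hstep
  have hτ (j : ℕ) : (1 + ·)^[j] (0 : ZMod n) = j := by simp
  have hper : IsPeriodicPt (1 + ·) n (0 : ZMod n) := by simp [IsPeriodicPt, IsFixedPt]
  have hmin : minimalPeriod (1 + ·) (0 : ZMod n) = n := ZMod.addOrderOf_one n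
  have horbit : orbitMeasure g (y 0) n = empiricalMeasure n fun j ↦ y j := by
    simp only [orbitMeasure_eq_empiricalMeasure, hg.iterate_apply, hτ]
  have hN : {x | (x, orbitMeasure g x n) ∈ W} ∈ 𝓝 (y 0) :=
    (hW.preimage (continuous_id.prodMk ((continuous_orbitMeasure n).comp
      (continuous_const.prodMk continuous_id)))).mem_nhds (by simpa [horbit] using hyW)
  obtain ⟨a, b, -, -, hab, hlen, hshr⟩ := hg.exists_isPeriodicShrinking ⟨n, n.pos, hper⟩ hy hN
    (δ := 1 / q) (by positivity)
  exact ⟨g, ⟨a, b, n, hmin ▸ hshr, hlen, hab⟩, hgf⟩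

theorem dist_iterate_val_lt {n : ℕ+} {x : I} {ε : ℝ} (hx : dist (f^[n] x) x < ε) (i : ZMod n) :
    dist (f^[(1 + i).val] x) (f (f^[i.val] x)) < ε := by
  have hval : (1 + i).val = (i.val + 1) % n := by
    rw [add_comm, ZMod.val_add, ZMod.val_one_eq_one_mod, Nat.add_mod_mod]
  rw [hval, ← iterate_succ_apply' f, Nat.succ_eq_add_one]
  obtain hlt | heq : i.val + 1 < n ∨ i.val + 1 = n := (Nat.succ_le_of_lt (ZMod.val_lt i)).lt_or_eq
  · rw [Nat.mod_eq_of_lt hlt, dist_self]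
    exact dist_nonneg.trans_lt hx
  · rw [heq, Nat.mod_self, dist_comm]
    exact hx

theorem mem_closure_shrinkingIn (hW : IsOpen W) (hq : 1 ≤ q)
    (h : ∀ δ > 0, ∃ (x : I) (n : ℕ+), dist (f^[n] x) x < δ ∧ (x, orbitMeasure f x n) ∈ W) :
    f ∈ closure (shrinkingIn W q) := by
  refine Metric.mem_closure_iff.2 fun ε hε ↦ ?_
  obtain ⟨x, n, hxn, hxW⟩ := h ε hε
  let O : Set (ZMod n → I) := {y | (∀ i, dist (y (1 + i)) (f (y i)) < ε) ∧
    (y 0, empiricalMeasure n fun j ↦ y j) ∈ W}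
  have hstep : IsOpen {y : ZMod n → I | ∀ i, dist (y (1 + i)) (f (y i)) < ε} := by
    rw [ofPred_forall]
    exact isOpen_iInter_of_finite fun i ↦ isOpen_lt (by fun_prop) continuous_const
  have hcont : Continuous fun y : ZMod n → I ↦ (y 0, empiricalMeasure n fun j ↦ y j) :=
    (continuous_apply 0).prodMk
      ((continuous_empiricalMeasure n).comp (continuous_pi fun j ↦ continuous_apply (j : ZMod n)))
  have hO : IsOpen O := hstep.and (hW.preimage hcont)
  have hxO : (fun i : ZMod n ↦ f^[i.val] x) ∈ O := by
    refine ⟨dist_iterate_val_lt hxn, ?_⟩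
    rw [empiricalMeasure_congr (w := fun j ↦ f^[j] x) fun j hj ↦
      congrArg (f^[·] x) (ZMod.val_natCast_of_lt hj)]
    simpa [orbitMeasure_eq_empiricalMeasure] using hxW
  obtain ⟨y, hy, hinj, hyt⟩ := (dense_setOf_injective_forall_notMem (t := ({0, 1} : Set I))
    (toFinite _)).inter_open_nonempty O hO ⟨_, hxO⟩
  have hy0 : y 0 ∈ Ioo (0 : I) 1 :=
    ⟨unitInterval.pos_iff_ne_zero.2 fun h0 ↦ hyt 0 (.inl h0),
      unitInterval.lt_one_iff_ne_one.2 fun h1 ↦ hyt 0 (.inr h1)⟩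
  obtain ⟨g, hg, hgf⟩ := exists_mem_shrinkingIn_dist_lt hW hq hinj hy0 hε hy.1 hy.2
  exact ⟨g, hg, dist_comm f g ▸ hgf⟩

end ShrinkingIn

/-! ### Orbit segments of ergodic measures -/

section MeanErgodic

variable {α : Type*} [MeasurableSpace α] {μ : Measure α} {f : α → α}

theorem exists_mem_iterate_mem_notMem [IsFiniteMeasure μ] (hf : MeasurePreserving f μ μ)
    {V : Set α} (hV : NullMeasurableSet V μ) (hμV : μ V ≠ 0) {B : ℕ → Set α}
    (hB : Tendsto (fun n ↦ μ (B n)) atTop (𝓝 0)) :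
    ∃ n, 0 < n ∧ ∃ x ∈ V, f^[n] x ∈ V ∧ x ∉ B n := by
  obtain ⟨k, hk⟩ := ENNReal.exists_nat_mul_gt hμV (measure_ne_top μ univ)
  let E (N : ℕ) : Set α := ⋃ m ∈ Finset.Ioo 0 k, toMeasurable μ (B (m * N))
  have hE : Tendsto (fun N ↦ μ (E N)) atTop (𝓝 0) := by
    have hsum : Tendsto (fun N ↦ ∑ m ∈ Finset.Ioo 0 k, μ (B (m * N))) atTop (𝓝 0) := by
      simpa using tendsto_finsetSum (Finset.Ioo 0 k) fun m hm ↦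
        hB.comp (tendsto_id.const_mul_atTop' (Finset.mem_Ioo.1 hm).1)
    refine tendsto_of_tendsto_of_tendsto_of_le_of_le tendsto_const_nhds hsum
      (fun _ ↦ zero_le) fun N ↦ ?_
    simpa only [measure_toMeasurable] using
      measure_biUnion_finset_le (μ := μ) (Finset.Ioo 0 k) fun m ↦ toMeasurable μ (B (m * N))
  have hlim : Tendsto (fun N ↦ k * (μ V - μ (E N))) atTop (𝓝 (k * μ V)) := by
    simpa using ENNReal.Tendsto.const_mul (a := (k : ENNReal))
      (ENNReal.Tendsto.sub tendsto_const_nhds hE (.inl (measure_ne_top μ V)))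
      (.inr (ENNReal.natCast_ne_top k))
  obtain ⟨N, hN, hN0⟩ := ((hlim.eventually_const_lt hk).and (eventually_gt_atTop 0)).exists
  have hEm : MeasurableSet (E N) :=
    Finset.measurableSet_biUnion _ fun m _ ↦ measurableSet_toMeasurable μ _
  obtain ⟨x, hx, m, hm, hmx⟩ :=
    (hf.iterate N).exists_mem_iterate_mem_of_measure_univ_lt_mul_measure
      (hV.diff hEm.nullMeasurableSet) (hN.trans_le (by gcongr; exact le_measure_sdiff))
  refine ⟨m * N, Nat.mul_pos hm.1 hN0, x, hx.1, ?_, fun hxB ↦ hx.2 ?_⟩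
  · rw [mul_comm, iterate_mul]
    exact hmx.1
  · exact mem_biUnion (Finset.mem_coe.2 (Finset.mem_Ioo.2 hm)) (subset_toMeasurable μ _ hxB)

theorem birkhoffAverage_compMeasurePreserving_toLp (hf : MeasurePreserving f μ μ) {φ : α → ℝ}
    (hφ : MemLp φ 2 μ) (n : ℕ) :
    (birkhoffAverage ℝ (Lp.compMeasurePreserving f hf) id n (hφ.toLp φ) : Lp ℝ 2 μ)
      =ᵐ[μ] birkhoffAverage ℝ f φ n := by
  have hcomp (j : ℕ) : (Lp.compMeasurePreserving f hf)^[j] (hφ.toLp φ) =ᵐ[μ] φ ∘ f^[j] := by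
    rw [Lp.compMeasurePreserving_iterate, Lp.toLp_compMeasurePreserving]
    exact MemLp.coeFn_toLp _
  simp only [birkhoffAverage, birkhoffSum, id]
  filter_upwards [Lp.coeFn_smul (n : ℝ)⁻¹
      (∑ j ∈ Finset.range n, (Lp.compMeasurePreserving f hf)^[j] (hφ.toLp φ)),
    Lp.coeFn_finsetSum (Finset.range n) fun j ↦ (Lp.compMeasurePreserving f hf)^[j] (hφ.toLp φ),
    ae_all_iff.2 hcomp] with x hsmul hsum hcompx
  rw [hsmul, Pi.smul_apply, hsum]
  simp [hcompx, birkhoffAverage, birkhoffSum]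

variable [IsProbabilityMeasure μ]

theorem inner_const_one_left (u : Lp ℝ 2 μ) : inner ℝ (Lp.const 2 μ (1 : ℝ)) u = ∫ x, u x ∂μ := by
  rw [← indicatorConstLp_univ, L2.inner_indicatorConstLp_one, setIntegral_univ]

theorem tendsto_birkhoffAverage_compMeasurePreserving (h : Ergodic f μ) (u : Lp ℝ 2 μ) :
    Tendsto (birkhoffAverage ℝ (Lp.compMeasurePreserving f h.toMeasurePreserving) id · u) atTop
      (𝓝 (Lp.const 2 μ (∫ x, u x ∂μ))) := by
  let T : Lp ℝ 2 μ →L[ℝ] Lp ℝ 2 μ :=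
    (Lp.compMeasurePreservingₗᵢ ℝ f h.toMeasurePreserving).toContinuousLinearMap
  set v := (T.eqLocus (1 : Lp ℝ 2 μ →L[ℝ] Lp ℝ 2 μ)).orthogonalProjectionOnto u with hv
  have hTv : Lp.compMeasurePreserving f h.toMeasurePreserving (v : Lp ℝ 2 μ) = v := v.2
  obtain ⟨c, hc⟩ := h.eq_const_of_compMeasurePreserving_eq (congrArg Subtype.val hTv)
  have hvc : (v : Lp ℝ 2 μ) = Lp.const 2 μ c := Subtype.ext hc
  have hone : Lp.const 2 μ (1 : ℝ) ∈ T.eqLocus (1 : Lp ℝ 2 μ →L[ℝ] Lp ℝ 2 μ) := rfl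
  have hcu : c = ∫ x, u x ∂μ := by
    rw [← inner_const_one_left,
      ← Submodule.inner_orthogonalProjectionOnto_eq_of_mem_left ⟨_, hone⟩ u, ← hv,
      Submodule.coe_inner, inner_const_one_left, hvc, integral_congr_ae (Lp.coeFn_const _ _ c)]
    simp
  rw [← hcu, ← hvc]
  exact T.tendsto_birkhoffAverage_orthogonalProjection
    (LinearIsometry.norm_toContinuousLinearMap_le _) u

theorem tendstoInMeasure_birkhoffAverage (h : Ergodic f μ) {φ : α → ℝ} (hφ : MemLp φ 2 μ) :
    TendstoInMeasure μ (birkhoffAverage ℝ f φ) atTop fun _ ↦ ∫ x, φ x ∂μ := by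
  refine (tendstoInMeasure_of_tendsto_Lp
    (tendsto_birkhoffAverage_compMeasurePreserving h (hφ.toLp φ))).congr
    (birkhoffAverage_compMeasurePreserving_toLp h.toMeasurePreserving hφ) ?_
  rw [integral_congr_ae hφ.coeFn_toLp]
  exact Lp.coeFn_const _ _ _

end MeanErgodic

/-- Orbit segments of `f` starting near `c` nearly close up while their empirical measures are
near `μ`. This is what allows `μ` to be approached by periodic measures of perturbations of `f`. -/
def IsClosable (f : C(I, I)) (c : I) (μ : ProbabilityMeasure I) : Prop :=
  ∀ W ∈ 𝓝 (c, μ), ∀ δ > 0, ∃ (x : I) (n : ℕ+), dist (f^[n] x) x < δ ∧ (x, orbitMeasure f x n) ∈ W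

theorem memLp_coe_continuousMap (ψ : C(I, I)) (p : ENNReal) (μ : ProbabilityMeasure I) :
    MemLp (fun x ↦ (ψ x : ℝ)) p (μ : Measure I) :=
  (continuous_subtype_val.comp ψ.continuous).memLp_of_hasCompactSupport
    (HasCompactSupport.of_compactSpace _)

theorem isClosable_of_ergodic {f : C(I, I)} {μ : ProbabilityMeasure I}
    (h : Ergodic f (μ : Measure I)) {c : I} (hc : c ∈ (μ : Measure I).support) :
    IsClosable f c μ := by
  intro W hW δ hδ
  obtain ⟨Ψ, hΨ⟩ := TopologicalSpace.exists_dense_seq C(I, I)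
  obtain ⟨⟨ρ, ε⟩, ⟨hρ, hε⟩, hρε⟩ :=
    (Metric.nhds_basis_ball.prod_nhds (nhds_basis_measureDist hΨ μ)).mem_iff.1 hW
  obtain ⟨m, hm⟩ := exists_forall_measureDist_lt Ψ hε
  let B (n : ℕ) : Set I := ⋃ i ∈ Finset.range m, {x | ε / 2 ≤
    dist (birkhoffAverage ℝ f (fun y ↦ (Ψ i y : ℝ)) n x) (∫ y, (Ψ i y : ℝ) ∂(μ : Measure I))}
  have hB : Tendsto (fun n ↦ (μ : Measure I) (B n)) atTop (𝓝 0) := by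
    have hsum := tendsto_finsetSum (Finset.range m) fun i _ ↦
      tendstoInMeasure_iff_dist.1 (tendstoInMeasure_birkhoffAverage h
        (φ := fun y ↦ (Ψ i y : ℝ)) (memLp_coe_continuousMap (Ψ i) 2 _)) (ε / 2) (half_pos hε)
    rw [Finset.sum_const_zero] at hsum
    exact tendsto_of_tendsto_of_tendsto_of_le_of_le tendsto_const_nhds hsum
      (fun _ ↦ zero_le) fun n ↦ measure_biUnion_finset_le _ _
  have hV : Metric.ball c (min ρ (δ / 2)) ∈ 𝓝 c := Metric.ball_mem_nhds c (by positivity)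
  obtain ⟨n, hn, x, hx, hnx, hxB⟩ := exists_mem_iterate_mem_notMem h.toMeasurePreserving
    Metric.isOpen_ball.measurableSet.nullMeasurableSet
    (Measure.mem_support_iff_forall c |>.1 hc _ hV).ne' hB
  have hclose : dist (f^[n] x) x < δ := by
    have hhalf := min_le_right ρ (δ / 2)
    linarith [dist_triangle_right (f^[n] x) x c, Metric.mem_ball.1 hx, Metric.mem_ball.1 hnx]
  lift n to ℕ+ using hn
  have hdist : measureDist Ψ (orbitMeasure f x n) μ < ε := by
    refine hm _ _ fun i hi ↦ ?_
    rw [orbitMeasure_eq_empiricalMeasure, integral_empiricalMeasure_iterate]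
    exact (not_le.1 fun hle ↦ hxB (mem_biUnion (Finset.mem_coe.2 (Finset.mem_range.2 hi)) hle)).le
  exact ⟨x, n, hclose, hρε ⟨Metric.ball_subset_ball (min_le_left _ _) hx, hdist⟩⟩

/-! ### Points captured by short shrinking intervals -/

/-- The points whose orbit enters a periodic shrinking interval of length less than `1/q`. -/
def capturedSet (f : C(I, I)) (q : ℕ) : Set I :=
  {x | ∃ (n : ℕ) (a b : I) (p : ℕ), IsPeriodicShrinking f a b p ∧ (b : ℝ) - a < 1 / q ∧
    f^[n] x ∈ Ioo a b}

theorem isOpen_setOf_mem_capturedSet (q : ℕ) :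
    IsOpen {r : C(I, I) × I | r.2 ∈ capturedSet r.1 q} := by
  refine isOpen_iff_mem_nhds.2 fun (f, x) ⟨n, a, b, p, h, hab, hx⟩ ↦ ?_
  filter_upwards [(h.eventually).prod_inl_nhds x,
    (isOpen_Ioo.preimage (continuous_iterate_apply n)).mem_nhds hx] with r hr hrx
  exact ⟨n, a, b, p, hr, hab, hrx⟩

theorem isOpen_setOf_lt_measure {X Y : Type*} [TopologicalSpace X] [TopologicalSpace Y]
    [MeasurableSpace X] {μ : Measure X} [μ.Regular] {O : Set (Y × X)} (hO : IsOpen O)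
    (c : ENNReal) : IsOpen {y | c < μ {x | (y, x) ∈ O}} := by
  refine isOpen_iff_mem_nhds.2 fun y hy ↦ ?_
  obtain ⟨K, hKO, hK, hcK⟩ :=
    (hO.preimage (Continuous.prodMk_right y)).exists_lt_isCompact (μ := μ) hy
  filter_upwards [hK.eventually_forall_of_forall_eventually (P := fun y x ↦ (y, x) ∈ O)
    fun x hx ↦ hO.mem_nhds (hKO hx)] with z hz
  exact hcK.trans_le (measure_mono hz)

theorem isOpen_setOf_lt_volume_capturedSet (q : ℕ) (c : ENNReal) :
    IsOpen {f | c < volume (capturedSet f q)} :=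
  isOpen_setOf_lt_measure (isOpen_setOf_mem_capturedSet q) c

theorem exists_iterate_succ_mem_periodicPts {ι : Type*} [Finite ι] (τ : ι → ι) (i : ι) :
    ∃ n, τ^[n + 1] i ∈ periodicPts τ := by
  obtain ⟨m, n, hmn, heq⟩ :=
    (finite_univ (α := ι)).exists_lt_map_eq_of_forall_mem (f := fun n : ℕ ↦ τ^[n + 1] i)
      fun _ ↦ mem_univ _
  refine ⟨m, n - m, Nat.sub_pos_of_lt hmn, ?_⟩
  rw [IsPeriodicPt, IsFixedPt, ← iterate_add_apply, ← add_assoc, Nat.sub_add_cancel hmn.le]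
  exact heq.symm

theorem IsFiniteModel.subset_capturedSet {ι : Type*} [Finite ι] {g : C(I, I)} {K : ι → Set I}
    {y : ι → I} {τ : ι → ι} (h : IsFiniteModel g K y τ) (hy : ∀ i, y i ∈ Ioo 0 1) {q : ℕ}
    (hq : 1 ≤ q) (i : ι) : K i ⊆ capturedSet g q := by
  intro x hx
  obtain ⟨n, hn⟩ := exists_iterate_succ_mem_periodicPts τ i
  obtain ⟨a, b, ha, hb, -, hab, hs⟩ :=
    h.exists_isPeriodicShrinking hn (hy _) univ_mem (δ := 1 / q) (by positivity)
  exact ⟨n + 1, a, b, _, hs, hab, by rw [h.iterate_succ_apply hx]; exact ⟨ha, hb⟩⟩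

section Grid

variable {N : ℕ}

theorem two_mul_add_one_div_mem_Ioo (i : Fin N) :
    ((2 * i + 1) / (2 * N) : ℝ) ∈ Ioo (0 : ℝ) 1 := by
  have hi : (i : ℝ) + 1 ≤ N := mod_cast i.2
  have hN : (0 : ℝ) < N := mod_cast i.pos
  exact ⟨by positivity, (div_lt_one (by positivity)).2 (by linarith)⟩

/-- The centre of the `i`-th of the `N` intervals of equal length dividing `[0, 1]`. -/
noncomputable def gridPoint (i : Fin N) : I :=
  ⟨(2 * i + 1) / (2 * N), Ioo_subset_Icc_self (two_mul_add_one_div_mem_Ioo i)⟩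

theorem gridPoint_mem_Ioo (i : Fin N) : gridPoint i ∈ Ioo 0 1 :=
  two_mul_add_one_div_mem_Ioo i

theorem dist_gridPoint (i j : Fin N) :
    dist (gridPoint i) (gridPoint j) = |(i : ℝ) - j| / N := by
  rw [Subtype.dist_eq, Real.dist_eq, gridPoint, gridPoint, ← sub_div, add_sub_add_right_eq_sub,
    ← mul_sub, mul_div_mul_left _ _ two_ne_zero, abs_div, Nat.abs_cast]

theorem exists_dist_gridPoint_le (hN : 0 < N) (w : I) :
    ∃ i : Fin N, dist (gridPoint i) w ≤ 1 / (2 * N) := by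
  have hN0 : (0 : ℝ) < N := mod_cast hN
  have hceil : ⌈(w * N : ℝ)⌉₊ ≤ N := Nat.ceil_le.2 (mul_le_of_le_one_left hN0.le w.2.2)
  refine ⟨⟨⌈(w * N : ℝ)⌉₊ - 1, by omega⟩, ?_⟩
  have hlower : ((⌈(w * N : ℝ)⌉₊ - 1 : ℕ) : ℝ) ≤ w * N :=
    (Nat.le_floor_iff (mul_nonneg w.2.1 hN0.le)).1
      (Nat.sub_le_iff_le_add.2 (Nat.ceil_le_floor_add_one _))
  have hupper : (w * N : ℝ) ≤ (⌈(w * N : ℝ)⌉₊ - 1 : ℕ) + 1 :=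
    (Nat.le_ceil _).trans (mod_cast le_tsub_add)
  rw [Subtype.dist_eq, Real.dist_eq, gridPoint, div_sub' (by positivity), abs_div,
    abs_of_pos (by positivity : (0 : ℝ) < 2 * N)]
  gcongr
  rw [abs_le]
  constructor <;> linarith

theorem volume_closedBall_of_Icc_subset {x : I} {r : ℝ} (h : Icc (x - r) (x + r) ⊆ Icc (0 : ℝ) 1) :
    volume (Metric.closedBall x r) = ENNReal.ofReal (2 * r) := by
  rw [unitInterval.volume_apply, ← Subtype.preimage_closedBall, Subtype.image_preimage_coe,
    Real.closedBall_eq_Icc, inter_eq_right.2 h, Real.volume_Icc]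
  congr 1
  ring

theorem volume_closedBall_gridPoint {θ : ℝ} (hθ : θ ≤ 1) (i : Fin N) :
    volume (Metric.closedBall (gridPoint i) (θ / (2 * N))) = ENNReal.ofReal (θ / N) := by
  have hi : (i : ℝ) + 1 ≤ N := mod_cast i.2
  have hN : (0 : ℝ) < 2 * N := mod_cast Nat.mul_pos two_pos i.pos
  rw [volume_closedBall_of_Icc_subset]
  · congr 1
    rw [← mul_div_assoc, mul_div_mul_left _ _ two_ne_zero]
  · rw [gridPoint, ← sub_div, ← add_div]
    refine Icc_subset_Icc (div_nonneg ?_ hN.le) ((div_le_one hN).2 ?_) <;> linarith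

theorem pairwise_disjoint_closedBall_gridPoint {θ : ℝ} (hθ : θ < 1) :
    Pairwise (Disjoint on fun i : Fin N ↦ Metric.closedBall (gridPoint i) (θ / (2 * N))) := by
  intro i j hij
  have hN : (0 : ℝ) < N := mod_cast i.pos
  have hsep : (1 : ℝ) ≤ |(i : ℝ) - j| := by
    exact_mod_cast Int.one_le_abs (show (i : ℤ) - j ≠ 0 by omega)
  refine Metric.closedBall_disjoint_closedBall ?_
  rw [dist_gridPoint, ← add_div, ← two_mul, mul_div_mul_left _ _ two_ne_zero]
  gcongr
  exact hθ.trans_le hsep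

theorem volume_iUnion_closedBall_gridPoint (hN : 0 < N) {θ : ℝ} (hθ : θ < 1) :
    volume (⋃ i : Fin N, Metric.closedBall (gridPoint i) (θ / (2 * N))) = ENNReal.ofReal θ := by
  rw [measure_iUnion (pairwise_disjoint_closedBall_gridPoint hθ)
    fun _ ↦ Metric.isClosed_closedBall.measurableSet]
  simp only [volume_closedBall_gridPoint hθ.le, tsum_fintype, Finset.sum_const, Finset.card_univ,
    Fintype.card_fin]
  rw [← ENNReal.ofReal_nsmul, nsmul_eq_mul, mul_div_cancel₀ _ (mod_cast hN.ne')]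

theorem exists_isFiniteModel_closedBall_gridPoint (f : C(I, I)) {θ : ℝ} (hθ0 : 0 < θ) (hθ : θ < 1)
    {ε : ℝ} (hε : 0 < ε) : ∃ N > 0, ∃ (g : C(I, I)) (τ : Fin N → Fin N), dist g f < ε ∧
      IsFiniteModel g (fun i ↦ Metric.closedBall (gridPoint i) (θ / (2 * N))) gridPoint τ := by
  obtain ⟨δ, hδ, hfδ⟩ := Metric.uniformContinuous_iff.1
    (CompactSpace.uniformContinuous_of_continuous f.continuous) (ε / 2) (half_pos hε)
  obtain ⟨N, hNδ, hN⟩ := ((tendsto_one_div_atTop_nhds_zero_nat.eventually_lt_const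
    (lt_min hδ (half_pos hε))).and (eventually_gt_atTop 0)).exists
  have hN0 : (0 : ℝ) < N := mod_cast hN
  have hhalf : 1 / (2 * N : ℝ) ≤ 1 / N := by gcongr; linarith
  choose τ hτ using fun i : Fin N ↦ exists_dist_gridPoint_le hN (f (gridPoint i))
  have hclose (i : Fin N) (x : I) (hx : x ∈ Metric.closedBall (gridPoint i) (θ / (2 * N))) :
      dist (gridPoint (τ i)) (f x) < ε := by
    have hxi : dist x (gridPoint i) < δ := by
      refine (Metric.mem_closedBall.1 hx).trans_lt ((le_trans ?_ hhalf).trans_lt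
        (hNδ.trans_le (min_le_left _ _)))
      gcongr
    have hτi : dist (gridPoint (τ i)) (f (gridPoint i)) < ε / 2 :=
      ((hτ i).trans hhalf).trans_lt (hNδ.trans_le (min_le_right _ _))
    linarith [dist_triangle_right (gridPoint (τ i)) (f x) (f (gridPoint i)), hfδ hxi]
  obtain ⟨g, hgf, hg⟩ := exists_isFiniteModel_of_isClosed f
    (fun i : Fin N ↦ Metric.isClosed_closedBall) (pairwise_disjoint_closedBall_gridPoint hθ)
    (fun i ↦ Metric.closedBall_mem_nhds _ (by positivity)) hε hclose
  exact ⟨N, hN, g, τ, hgf, hg⟩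

end Grid

theorem dense_setOf_lt_volume_capturedSet {q : ℕ} (hq : 1 ≤ q) {c : ENNReal} (hc : c < 1) :
    Dense {f | c < volume (capturedSet f q)} := by
  obtain ⟨θ, hcθ, hθ⟩ := ENNReal.lt_iff_exists_nnreal_btwn.1 hc
  have hθ0 : (0 : ℝ) < θ := mod_cast (zero_le (a := c)).trans_lt hcθ
  have hθ1 : (θ : ℝ) < 1 := mod_cast hθ
  refine Metric.dense_iff.2 fun f ε hε ↦ ?_
  obtain ⟨N, hN, g, τ, hgf, hg⟩ := exists_isFiniteModel_closedBall_gridPoint f hθ0 hθ1 hε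
  refine ⟨g, hgf, hcθ.trans_le ?_⟩
  rw [← ENNReal.ofReal_coe_nnreal, ← volume_iUnion_closedBall_gridPoint hN hθ1]
  exact measure_mono (iUnion_subset (hg.subset_capturedSet gridPoint_mem_Ioo hq))

/-! ### Typical maps -/

/-- The two generic properties of interval maps that rule their invariant measures: pairs `(c, μ)`
as in `IsClosable` are approached by short periodic shrinking intervals with their empirical
measures, and almost every point is captured by arbitrarily short such intervals. -/
structure IsTypical (f : C(I, I)) : Prop where
  mem_shrinkingIn : ∀ c μ, IsClosable f c μ → ∀ W ∈ 𝓝 (c, μ), ∀ q : ℕ, 1 ≤ q → f ∈ shrinkingIn W q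
  ae_mem_capturedSet : ∀ᵐ x : I, ∀ q : ℕ, 1 ≤ q → x ∈ capturedSet f q

theorem eventually_residual_mem_of_mem_closure {X : Type*} [TopologicalSpace X] {U : Set X}
    (hU : IsOpen U) : ∀ᶠ x in residual X, x ∈ closure U → x ∈ U := by
  have hnd : IsNowhereDense (frontier U) := by
    rw [isClosed_frontier.isNowhereDense_iff, ← frontier_compl, interior_frontier hU.isClosed_compl]
  filter_upwards [hnd.isMeagre] with x hx hxU
  exact not_not.1 fun hxU' ↦ hx (hU.frontier_eq ▸ ⟨hxU, hxU'⟩)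

theorem eventually_residual_mem_shrinkingIn :
    ∀ᶠ f : C(I, I) in residual C(I, I), ∀ c μ, IsClosable f c μ → ∀ W ∈ 𝓝 (c, μ), ∀ q : ℕ,
      1 ≤ q → f ∈ shrinkingIn W q := by
  let := TopologicalSpace.metrizableSpaceMetric (ProbabilityMeasure I)
  obtain ⟨B, hBc, -, hB⟩ := TopologicalSpace.exists_countable_basis (I × ProbabilityMeasure I)
  have hres : ∀ᶠ f in residual C(I, I), ∀ V ∈ B, ∀ q : ℕ,
      f ∈ closure (shrinkingIn V q) → f ∈ shrinkingIn V q :=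
    (eventually_countable_ball hBc).2 fun V hV ↦ eventually_countable_forall.2 fun q ↦
      eventually_residual_mem_of_mem_closure (isOpen_shrinkingIn (hB.isOpen hV))
  filter_upwards [hres] with f hf c μ hcμ W hW q hq
  obtain ⟨V, hVB, hV, hVW⟩ := hB.mem_nhds_iff.1 hW
  have hVo := hB.isOpen hVB
  obtain ⟨a, b, p, hs, hlen, hsV⟩ :=
    hf V hVB q (mem_closure_shrinkingIn hVo hq (hcμ V (hVo.mem_nhds hV)))
  exact ⟨a, b, p, hs, hlen, fun x hx ↦ hVW (hsV x hx)⟩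

theorem eventually_residual_ae_mem_capturedSet {q : ℕ} (hq : 1 ≤ q) :
    ∀ᶠ f : C(I, I) in residual C(I, I), ∀ᵐ x : I, x ∈ capturedSet f q := by
  obtain ⟨u, -, hu, hlim⟩ := exists_seq_strictMono_tendsto' (zero_lt_one (α := ENNReal))
  have hres : ∀ᶠ f in residual C(I, I), ∀ k, u k < volume (capturedSet f q) :=
    eventually_countable_forall.2 fun k ↦ residual_of_dense_open
      (isOpen_setOf_lt_volume_capturedSet q (u k)) (dense_setOf_lt_volume_capturedSet hq (hu k).2)
  filter_upwards [hres] with f hf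
  refine (mem_ae_iff_prob_eq_one ?_).2
    (prob_le_one.antisymm (le_of_tendsto' hlim fun k ↦ (hf k).le))
  exact ((isOpen_setOf_mem_capturedSet q).preimage (Continuous.prodMk_right f)).measurableSet

theorem eventually_residual_isTypical : ∀ᶠ f in residual C(I, I), IsTypical f := by
  have hcap : ∀ᶠ f : C(I, I) in residual C(I, I), ∀ q : ℕ, 1 ≤ q → ∀ᵐ x : I, x ∈ capturedSet f q :=
    eventually_countable_forall.2 fun q ↦ eventually_countable_forall.2
      eventually_residual_ae_mem_capturedSet
  filter_upwards [eventually_residual_mem_shrinkingIn, hcap] with f hshr hcap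
  exact ⟨hshr, ae_all_iff.2 fun q ↦ ae_all_iff.2 (hcap q)⟩

/-! ### Invariant measures of typical maps -/

section Invariant

variable {f : C(I, I)}

theorem IsPeriodicShrinking.pomega_orbitSet {a b : I} {p : ℕ} (h : IsPeriodicShrinking f a b p)
    {x : I} {n : ℕ} (hx : f^[n] x ∈ Icc a b) {ν : ProbabilityMeasure I} (hν : ν ∈ pomega f x) :
    (ν : Measure I) (orbitSet f a b p) = 1 := by
  refine measure_eq_one_of_mem_pomega (isClosed_orbitSet f a b p) (m := n + 1) (fun j ↦ ?_) hν
  rw [iterate_succ_apply' f n, ← iterate_succ_apply f j]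
  exact h.iterate_succ_mem_orbitSet hx j

theorem pomega_subset_shrinkedMeasures {x : I} (hx : ∀ q : ℕ, 1 ≤ q → x ∈ capturedSet f q) :
    pomega f x ⊆ shrinkedMeasures f := by
  refine fun ν hν ↦ ⟨pomega_subset_invariantMeasures f x hν, fun q hq ↦ ?_⟩
  obtain ⟨n, a, b, p, hs, hlen, hn⟩ := hx q hq
  exact ⟨a, b, p, hs, hlen, hs.pomega_orbitSet (Ioo_subset_Icc_self hn) hν⟩

theorem periodicMeasures_subset_ergodicMeasures : periodicMeasures f ⊆ ergodicMeasures f := by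
  rintro μ ⟨x, r, hr, rfl⟩
  have hinv : orbitMeasure f x r ∈ invariantMeasures f :=
    orbitMeasure_mem_invariantMeasures (hr ▸ isPeriodicPt_minimalPeriod f x)
  have hae {s : Set I} (hs : MeasurableSet s) (hfs : f ⁻¹' s = s) (hxs : x ∈ s) :
      s ∈ ae (orbitMeasure f x r : Measure I) :=
    (mem_ae_iff_prob_eq_one hs).2 <| empiricalMeasure_apply_eq_one hs fun j _ ↦
      MapsTo.iterate (mapsTo_iff_subset_preimage.2 hfs.ge) j hxs
  refine { toMeasurePreserving := hinv, aeconst_set := fun s hs hfs ↦ eventuallyConst_set.2 ?_ }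
  by_cases hxs : x ∈ s
  · exact .inl (hae hs hfs hxs)
  · exact .inr (hae hs.compl (congrArg compl hfs) hxs)

theorem shrinkedPeriodic_subset_approxShrinkedPeriodic (Ψ : ℕ → C(I, I)) {ε : ℝ} (hε : 0 < ε)
    (q : ℕ) : shrinkedPeriodic f q ⊆ approxShrinkedPeriodic Ψ f ε q := fun μ hμ ↦
  ⟨(periodicMeasures_subset_ergodicMeasures hμ.1).toMeasurePreserving, μ, hμ,
    (measureDist_self Ψ μ).trans_lt hε⟩

theorem isClosed_pseudoPhysical (Ψ : ℕ → C(I, I)) (f : C(I, I)) :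
    IsClosed (pseudoPhysical Ψ f) := by
  refine isClosed_of_closure_subset fun μ hμ ε hε ↦ ?_
  obtain ⟨ν, hνμ, hν⟩ :=
    mem_closure_iff_nhds.1 hμ _ (setOf_measureDist_lt_mem_nhds Ψ μ (half_pos hε))
  refine (hν (ε / 2) (half_pos hε)).trans_le (measure_mono ?_)
  rintro x ⟨ρ, hρ, hρν⟩
  have hνμ : measureDist Ψ ν μ < ε / 2 := hνμ
  refine ⟨ρ, hρ, ?_⟩
  linarith [measureDist_triangle Ψ ρ ν μ]

variable {Ψ : ℕ → C(I, I)}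

theorem shrinkedMeasures_subset_closure_periodicMeasures (hΨ : DenseRange Ψ) :
    shrinkedMeasures f ⊆ closure (periodicMeasures f) := by
  rintro μ ⟨hμ, hq⟩
  refine (mem_closure_iff_measureDist hΨ).2 fun ε hε ↦ ?_
  obtain ⟨q, hq1, hdist⟩ := exists_forall_isPeriodicShrinking_measureDist_lt Ψ hε
  obtain ⟨a, b, p, hs, hlen, hone⟩ := hq q hq1
  lift p to ℕ+ using hs.one_le
  obtain ⟨z, hz, hp⟩ := hs.exists_minimalPeriod_eq
  refine ⟨orbitMeasure f z p, ⟨z, p, hp, rfl⟩, ?_⟩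
  rw [measureDist_comm]
  exact hdist f a b p hs hlen z (Ioo_subset_Icc_self hz) (hp ▸ isPeriodicPt_minimalPeriod f z)
    μ hμ hone

namespace IsTypical

theorem ergodicMeasures_subset_closure_shrinkedPeriodic (hf : IsTypical f) {q : ℕ} (hq : 1 ≤ q) :
    ergodicMeasures f ⊆ closure (shrinkedPeriodic f q) := by
  refine fun μ hμ ↦ mem_closure_iff_nhds.2 fun U hU ↦ ?_
  obtain ⟨c, hc⟩ := Measure.nonempty_support (IsProbabilityMeasure.ne_zero (μ : Measure I))
  obtain ⟨a, b, p, hs, hlen, hW⟩ := hf.mem_shrinkingIn c μ (isClosable_of_ergodic hμ hc)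
    (Prod.snd ⁻¹' U) (continuous_snd.continuousAt hU) q hq
  obtain ⟨z, hz, hp⟩ := hs.exists_minimalPeriod_eq
  have hz := Ioo_subset_Icc_self hz
  exact ⟨orbitMeasure f z p, hW z hz, ⟨z, p, hp, rfl⟩, a, b, p, hs, hlen,
    hs.orbitMeasure_orbitSet hz (hp ▸ isPeriodicPt_minimalPeriod f z)⟩

theorem ergodicMeasures_subset_pseudoPhysical (hf : IsTypical f) (Ψ : ℕ → C(I, I)) :
    ergodicMeasures f ⊆ pseudoPhysical Ψ f := by
  intro μ hμ ε hε
  obtain ⟨q, hq, hdist⟩ := exists_forall_isPeriodicShrinking_measureDist_lt Ψ (half_pos hε)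
  obtain ⟨c, hc⟩ := Measure.nonempty_support (IsProbabilityMeasure.ne_zero (μ : Measure I))
  obtain ⟨a, b, p, hs, hlen, hW⟩ := hf.mem_shrinkingIn c μ (isClosable_of_ergodic hμ hc)
    (Prod.snd ⁻¹' {ν | measureDist Ψ ν μ < ε / 2})
    (continuous_snd.continuousAt (setOf_measureDist_lt_mem_nhds Ψ μ (half_pos hε))) q hq
  obtain ⟨z, hz, hp⟩ := hs.exists_minimalPeriod_eq
  have hz := Ioo_subset_Icc_self hz
  have hbasin : Ioo a b ⊆ basin Ψ f ε μ := by
    intro x hx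
    obtain ⟨ν, hν⟩ := pomega_nonempty f x
    have hνz := hdist f a b p hs hlen z hz (hp ▸ isPeriodicPt_minimalPeriod f z) ν
      (pomega_subset_invariantMeasures f x hν)
      (hs.pomega_orbitSet (n := 0) (Ioo_subset_Icc_self hx) hν)
    have hzμ : measureDist Ψ (orbitMeasure f z p) μ < ε / 2 := hW z hz
    refine ⟨ν, hν, ?_⟩
    linarith [measureDist_triangle Ψ ν (orbitMeasure f z p) μ]
  have hvol : 0 < volume (Ioo a b) := by
    rw [unitInterval.volume_Ioo, ENNReal.ofReal_pos, sub_pos]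
    exact hs.lt
  exact hvol.trans_le (measure_mono hbasin)

theorem pseudoPhysical_subset_closure_shrinkedMeasures (hf : IsTypical f) (hΨ : DenseRange Ψ) :
    pseudoPhysical Ψ f ⊆ closure (shrinkedMeasures f) := by
  refine fun μ hμ ↦ (mem_closure_iff_measureDist hΨ).2 fun ε hε ↦ ?_
  obtain ⟨x, ⟨ν, hν, hνμ⟩, hx⟩ :=
    (frequently_ae_mem_iff.2 (hμ ε hε).ne').and_eventually hf.ae_mem_capturedSet |>.exists
  exact ⟨ν, pomega_subset_shrinkedMeasures hx hν, hνμ⟩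

theorem closure_shrinkedMeasures (hf : IsTypical f) (hΨ : DenseRange Ψ) :
    closure (shrinkedMeasures f) = closure (periodicMeasures f) :=
  (closure_minimal (shrinkedMeasures_subset_closure_periodicMeasures hΨ) isClosed_closure).antisymm
    (closure_minimal (periodicMeasures_subset_ergodicMeasures.trans
      ((hf.ergodicMeasures_subset_pseudoPhysical Ψ).trans
        (hf.pseudoPhysical_subset_closure_shrinkedMeasures hΨ))) isClosed_closure)

theorem pseudoPhysical_eq_closure_shrinkedMeasures (hf : IsTypical f) (hΨ : DenseRange Ψ) :
    pseudoPhysical Ψ f = closure (shrinkedMeasures f) := by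
  refine (hf.pseudoPhysical_subset_closure_shrinkedMeasures hΨ).antisymm ?_
  rw [hf.closure_shrinkedMeasures hΨ]
  exact closure_minimal (periodicMeasures_subset_ergodicMeasures.trans
    (hf.ergodicMeasures_subset_pseudoPhysical Ψ)) (isClosed_pseudoPhysical Ψ f)

theorem closure_ergodicMeasures (hf : IsTypical f) :
    closure (ergodicMeasures f) = closure (periodicMeasures f) := by
  refine (closure_minimal ?_ isClosed_closure).antisymm
    (closure_mono periodicMeasures_subset_ergodicMeasures)
  exact (hf.ergodicMeasures_subset_closure_shrinkedPeriodic le_rfl).trans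
    (closure_mono fun _ h ↦ h.1)

theorem periodicMeasures_subset_closure_approxShrinkedPeriodic (hf : IsTypical f)
    (Ψ : ℕ → C(I, I)) {ε : ℝ} (hε : 0 < ε) {q : ℕ} (hq : 1 ≤ q) :
    periodicMeasures f ⊆ closure (approxShrinkedPeriodic Ψ f ε q) :=
  periodicMeasures_subset_ergodicMeasures.trans <|
    (hf.ergodicMeasures_subset_closure_shrinkedPeriodic hq).trans <|
      closure_mono (shrinkedPeriodic_subset_approxShrinkedPeriodic Ψ hε q)

theorem iInter_closure_approxShrinkedPeriodic (hf : IsTypical f) (hΨ : DenseRange Ψ) :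
    ⋂ (ε : ℝ) (_ : 0 < ε) (q : ℕ) (_ : 1 ≤ q), closure (approxShrinkedPeriodic Ψ f ε q) =
      closure (periodicMeasures f) := by
  refine subset_antisymm (fun μ hμ ↦ (mem_closure_iff_measureDist hΨ).2 fun ε hε ↦ ?_) ?_
  · have hμ : μ ∈ closure (approxShrinkedPeriodic Ψ f (ε / 2) 1) :=
      mem_iInter₂.1 (mem_iInter₂.1 hμ _ (half_pos hε)) 1 le_rfl
    obtain ⟨ν, ⟨-, ρ, hρ, hνρ⟩, hνμ⟩ := (mem_closure_iff_measureDist hΨ).1 hμ _ (half_pos hε)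
    refine ⟨ρ, hρ.1, ?_⟩
    linarith [measureDist_triangle Ψ ρ ν μ, measureDist_comm Ψ ν ρ]
  · refine subset_iInter₂ fun ε hε ↦ subset_iInter₂ fun q hq ↦ closure_minimal ?_ isClosed_closure
    exact hf.periodicMeasures_subset_closure_approxShrinkedPeriodic Ψ hε hq

end IsTypical

end Invariant

end IntervalDynamics

theorem mainTheorem1 (Ψ : ℕ → C(I, I)) (hΨ : DenseRange Ψ) :
    ∃ G : Set C(I, I), IsGδ G ∧ Dense G ∧ ∀ f ∈ G,
      (∀ ε : ℝ, 0 < ε →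
        periodicMeasures f ⊆ ⋂ (q : ℕ) (_ : 1 ≤ q), closure (approxShrinkedPeriodic Ψ f ε q)) ∧
      (⋂ (ε : ℝ) (_ : 0 < ε) (q : ℕ) (_ : 1 ≤ q), closure (approxShrinkedPeriodic Ψ f ε q)) =
        pseudoPhysical Ψ f ∧
      pseudoPhysical Ψ f = closure (shrinkedMeasures f) ∧
      closure (shrinkedMeasures f) = closure (ergodicMeasures f) ∧
      closure (ergodicMeasures f) = closure (periodicMeasures f) ∧
      (∀ μ : ProbabilityMeasure I, Ergodic f (μ : Measure I) → μ ∈ pseudoPhysical Ψ f) := by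
  obtain ⟨G, hG, hGδ, hGd⟩ := mem_residual.1 eventually_residual_isTypical
  refine ⟨G, hGδ, hGd, fun f hfG ↦ ?_⟩
  have hf : IsTypical f := hG hfG
  have hApproxPer := hf.iInter_closure_approxShrinkedPeriodic hΨ
  have hShrPer := hf.closure_shrinkedMeasures hΨ
  have hPhysShr := hf.pseudoPhysical_eq_closure_shrinkedMeasures hΨ
  exact ⟨fun ε hε ↦ subset_iInter₂ fun q hq ↦
      hf.periodicMeasures_subset_closure_approxShrinkedPeriodic Ψ hε hq,
    hApproxPer.trans (hShrPer.symm.trans hPhysShr.symm),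
    hPhysShr,
    hShrPer.trans hf.closure_ergodicMeasures.symm,
    hf.closure_ergodicMeasures,
    fun μ hμ ↦ hf.ergodicMeasures_subset_pseudoPhysical Ψ hμ⟩
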